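/- **Setting.** Let $\mathcal{L}$ be a countable single-sorted language for metric structures: function and relation symbols with arities and moduli of continuity, each relation symbol $B$ taking values in a compact interval $[\lambda_B,\mu_B]\subset\mathbb{R}$, together with a symbol for the metric. An $\mathcal{L}$-structure is a complete metric space with metric bounded by $1$, with interpretations of the symbols that respect the moduli for the supremum metric on tuples. A map $T:E\to F$ between structures is a *morphism* if $\varphi(T\bar a)\le\varphi(\bar a)$, and an *embedding* if $\varphi(T\bar a)=\varphi(\bar a)$, for all atomic formulas $\varphi$ and finite tuples $\bar a$ in $E$. Put $I(T)=\sup_{\varphi,\bar a}|\varphi(\bar a)-\varphi(T\bar a)|$ and $d(S,T)=\sup_x d(Sx,Tx)$; for tuples, $d(\bar a,\bar b)=\max_i d(a_i,b_i)$. The Gromov–Hausdorff distance of $X,Y$ is the infimum of the $\varepsilon>0$ for which there are morphisms $f:X\to Y$, $g:Y\to X$ with $d(gf,\mathrm{id}_X),\,d(fg,\mathrm{id}_Y),\,I(f),\,I(g)<\varepsilon$. Let $\mathcal{A}$ be a class of $\mathcal{L}$-structures, regarded as a category with all morphisms. For a finite tuple $\bar a$ in a structure $E$, $\langle\bar a\rangle\subset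 E$ is the set of $b\in E$ such that $f(b)=g(b)$ whenever $F\in\mathcal{A}$ and $f,g:E\to F$ are morphisms with $f(\bar a)=g(\bar a)$; it is a structure with the operations, relations and metric of $E$. A structure is *finitely generated* if it is isomorphic to such an $\langle\bar a\rangle$ with $E\in\mathcal{A}$. Products below are over nonempty index sets. Consider the following conditions on a class $\mathcal{K}\subset\mathcal{A}$ (with morphisms between its members): 1. a structure is in $\mathcal{K}$ iff $\langle\bar a\rangle\in\mathcal{K}$ for each of its finite tuples $\bar a$; 2. $\mathcal{K}$ is closed under inductive limits of directed systems with embeddings as connective maps; 3. $\mathcal{K}$ has arbitrary products; 4. $\mathcal{K}$ has an initial object, which is finitely generated; 5. if $f:X\to\prod_iY_i$ is the morphism in $\mathcal{K}$ with components $f_i:X\to Y_i$, then $\varphi(f(\bar a))=\sup_i\varphi(f_i(\bar a))$ for all atomic $\varphi$ and tuples $\bar a$ in $X$; 6. if $f^{(k)}:A\to X\times Y$ are the morphisms in $\mathcal{K}$ with components $f_X^{(k)},f_Y^{(k)}$, $k=1,\dots,n$, then $\varphi(f^{(1)}(\bar a),\dots,f^{(n)}(\bar a))\le\max\{\varphi(f_X^{(1)}(\bar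 a),\dots,f_X^{(n)}(\bar a)),\varphi(f_Y^{(1)}(\bar a),\dots,f_Y^{(n)}(\bar a))\}$ for all atomic $\varphi$ and tuples $\bar a$ in $A$; 7. for finitely generated $A,B\in\mathcal{K}$ the space of morphisms $A\to B$ is totally bounded for $d$; 8. each $X\in\mathcal{K}$ can be endowed with a collection of finite tuples of pairwise distinct elements, called basic, such that: every finitely generated $X\in\mathcal{K}$ has a basic tuple $\bar a$ with $\langle\bar a\rangle=X$; every finite tuple contains a basic subtuple; every separable $X\in\mathcal{K}$ has a countable subset $D$ such that $\bigcup\{\langle\bar a\rangle:\bar a\text{ a finite tuple in }D\}$ is dense in $X$ and the basic tuples from $D$ are dense among the basic tuples of $X$; and for every basic tuple $\bar a$ in $X\in\mathcal{K}$ there are $\delta_{\bar a}>0$ and a strictly increasing $\rho_{\bar a}:[0,\delta_{\bar a})\to[0,\infty)$, vanishing and continuous at $0$, such that for all morphisms $f,g:X\to Y$ with $Y\in\mathcal{K}$ and $d(f(\bar a),g(\bar a))\le\delta<\delta_{\bar a}$ there is a morphism $h:\langle f(\bar a)\rangle\to Y$ with $d(h(f(x)),g(x))\le\rho_{\bar a}(\delta)$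 for all $x\in\langle\bar a\rangle$. Let $\varpi:[0,\infty)\to[0,\infty)$ be strictly increasing, vanishing at $0$ and continuous at $0$. A class $\mathcal{K}\subset\mathcal{A}$ *has enough injectives from* $\mathcal{J}\subset\mathcal{K}$ *with modulus* $\varpi$ if every finitely generated structure in $\mathcal{K}$ is a Gromov–Hausdorff limit of structures $\langle\bar a\rangle$, $\bar a$ a finite tuple in some $A\in\mathcal{J}$, and whenever $X,\widehat X\in\mathcal{K}$ and $A\in\mathcal{J}$ are separable, $X$ is finitely generated, and $\phi:X\to\widehat X$, $f:X\to A$ are morphisms with $I(\phi)\le\delta$, there is a morphism $h:\widehat X\to A$ with $d(h\circ\phi,f)\le\varpi(\delta)$. **Stratified Fraïssé class.** Let $\mathcal{A}_q\subset\mathcal{A}$ ($q\in\mathbb{N}$) be classes with $\mathcal{A}_q\subset\mathcal{A}_{q+1}$, and let $\mathcal{I}_q\subset\mathcal{A}_q$ be countable collections of separable structures, injective in $\mathcal{A}_q$ (morphisms into them extend along embeddings), closed under finite products in $\mathcal{A}_q$, with $\mathcal{I}_q\subset\mathcal{I}_{q+1}$. Let $\mathcal{I}_\infty=\bigcup_q\mathcal{I}_q$,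 and let $\mathcal{I}\subset\mathcal{I}_\infty$ be such that every structure in $\mathcal{I}_\infty$ embeds in a structure in $\mathcal{I}$. Assume that $\mathcal{A}$ satisfies (1), (2), (4), has finite products, and that $I(T)<\infty$ for the morphisms $T$ from its initial object to structures in $\mathcal{A}$; that every $\mathcal{A}_q$ satisfies (1)–(8); that $\mathcal{A}_q$ has enough injectives from $\mathcal{I}_q$ with modulus $\varpi$ for every $q$; and that $\mathcal{A}$ has enough injectives from $\mathcal{I}_\infty$ with modulus $\varpi$. Let $M$ be the *Fraïssé limit* of the class of finitely generated structures in $\mathcal{A}$, that is, a separable structure in $\mathcal{A}$ with the approximate extension property: whenever $E,F\in\mathcal{A}$ are finitely generated, $\delta,\varepsilon>0$, and $\phi:E\to F$, $f:E\to M$ are morphisms with $I(\phi)<\delta$ and $I(f)<\delta$, there is a morphism $g:F\to M$ with $I(g)<\varepsilon$ and $d(g\circ\phi,f)<\varpi(\delta)$. A structure $X\in\mathcal{A}$ is *approximately injective* if for every $A\in\mathcal{I}$, finite tuple $\bar a$ in $A$, morphism $f:\langle\bar a\rangle\to X$ and $\varepsilon>0$ there is a morphism $g:A\to X$ with $d(g(\bar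 a),f(\bar a))\le\varepsilon$. **Theorem.** A separable structure $X$ in $\mathcal{A}$ is approximately injective if and only if there exist an embedding $\eta:X\to M$ and an idempotent morphism $\pi:M\to M$ such that the range of $\eta$ equals the range of $\pi$. -/

import Mathlib

open scoped NNReal ENNReal

namespace MetricFraisse

universe v u w

/-- A countable single-sorted language for metric structures: function and relation symbols with
arities and moduli of continuity; relation symbols take values in a compact interval. The
distinguished symbol for the metric is built into `Atomic` below. -/
structure Language where
  Fn : Type v
  Rel : Type v
  fn_countable : Countable Fn
  rel_countable : Countable Rel
  fnArity : Fn → ℕ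
  relArity : Rel → ℕ
  fnMod : Fn → ℝ≥0 → ℝ≥0
  relMod : Rel → ℝ≥0 → ℝ≥0
  fnMod_zero : ∀ f, fnMod f 0 = 0
  relMod_zero : ∀ R, relMod R 0 = 0
  fnMod_cont : ∀ f, ContinuousAt (fnMod f) 0
  relMod_cont : ∀ R, ContinuousAt (relMod R) 0
  lo : Rel → ℝ
  hi : Rel → ℝ
  lo_le_hi : ∀ R, lo R ≤ hi R

/-- An `L`-structure: a complete metric space with metric bounded by `1` and interpretations of the
symbols of `L` respecting the moduli, with respect to the supremum metric on tuples. -/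
structure Str (L : Language.{v}) where
  carrier : Type u
  [metric : MetricSpace carrier]
  [complete : CompleteSpace carrier]
  dist_le_one : ∀ x y : carrier, dist x y ≤ 1
  fn : ∀ f : L.Fn, (Fin (L.fnArity f) → carrier) → carrier
  fn_mod : ∀ f x y, nndist (fn f x) (fn f y) ≤ L.fnMod f (nndist x y)
  rel : ∀ R : L.Rel, (Fin (L.relArity R) → carrier) → ℝ
  rel_mem : ∀ R x, rel R x ∈ Set.Icc (L.lo R) (L.hi R)
  rel_mod : ∀ R x y, nndist (rel R x) (rel R y) ≤ L.relMod R (nndist x y)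

variable {L : Language.{v}}

instance : CoeSort (Str.{v, u} L) (Type u) := ⟨Str.carrier⟩
instance (X : Str.{v, u} L) : MetricSpace X := X.metric
instance (X : Str.{v, u} L) : CompleteSpace X := X.complete

/-- Terms in variables indexed by `α`. -/
inductive Term (L : Language.{v}) (α : Type w) : Type (max v w)
  | var : α → Term L α
  | app : (f : L.Fn) → (Fin (L.fnArity f) → Term L α) → Term L α

/-- Atomic formulas in variables indexed by `α`. -/
inductive Atomic (L : Language.{v}) (α : Type w) : Type (max v w)
  | dist : Term L α → Term L α → Atomic L α
  | rel : (R : L.Rel) → (Fin (L.relArity R) → Term L α) → Atomic L α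

/-- Value of a term in a structure. -/
def Term.eval {α : Type w} (X : Str.{v, u} L) (a : α → X) : Term L α → X
  | .var i => a i
  | .app f ts => X.fn f fun k => (ts k).eval X a

/-- Value of an atomic formula in a structure. -/
def Atomic.eval {α : Type w} (X : Str.{v, u} L) (a : α → X) : Atomic L α → ℝ
  | .dist s t => Dist.dist (s.eval X a) (t.eval X a)
  | .rel R ts => X.rel R fun k => (ts k).eval X a

/-- Morphisms do not increase the values of atomic formulas. -/
def IsMorphism {E F : Str.{v, u} L} (T : E → F) : Prop :=
  ∀ (n : ℕ) (φ : Atomic L (Fin n)) (a : Fin n → E),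
    φ.eval F (fun i => T (a i)) ≤ φ.eval E a

/-- Embeddings preserve the values of atomic formulas. -/
def IsEmbedding {E F : Str.{v, u} L} (T : E → F) : Prop :=
  ∀ (n : ℕ) (φ : Atomic L (Fin n)) (a : Fin n → E),
    φ.eval F (fun i => T (a i)) = φ.eval E a

/-- The distortion `I(T)`: the supremum of `|φ(a) - φ(T a)|` over atomic formulas and tuples. -/
noncomputable def distortion {E F : Str.{v, u} L} (T : E → F) : ℝ≥0∞ :=
  ⨆ (n : ℕ) (φ : Atomic L (Fin n)) (a : Fin n → E),
    ENNReal.ofReal |φ.eval E a - φ.eval F (fun i => T (a i))|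

/-- The uniform distance `d(S, T)`. -/
noncomputable def unifDist {E F : Str.{v, u} L} (S T : E → F) : ℝ≥0∞ :=
  ⨆ x : E, edist (S x) (T x)

/-- The Gromov-Hausdorff distance of two structures. -/
noncomputable def ghDist (X Y : Str.{v, u} L) : ℝ≥0∞ :=
  sInf {ε : ℝ≥0∞ | 0 < ε ∧ ∃ (f : X → Y) (g : Y → X), IsMorphism f ∧ IsMorphism g ∧
    unifDist (g ∘ f) id < ε ∧ unifDist (f ∘ g) id < ε ∧ distortion f < ε ∧ distortion g < ε}

theorem IsMorphism.dist_le {E F : Str.{v, u} L} {T : E → F} (hT : IsMorphism T) (x y : E) :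
    dist (T x) (T y) ≤ dist x y := by
  have h := hT 2 (.dist (.var 0) (.var 1)) ![x, y]
  simpa [Atomic.eval, Term.eval] using h

theorem IsMorphism.continuous {E F : Str.{v, u} L} {T : E → F} (hT : IsMorphism T) :
    Continuous T :=
  (LipschitzWith.of_dist_le_mul (K := 1) (by simpa using hT.dist_le)).continuous

theorem IsMorphism.map_fn {E F : Str.{v, u} L} {T : E → F} (hT : IsMorphism T) (f : L.Fn)
    (x : Fin (L.fnArity f) → E) : T (E.fn f x) = F.fn f (fun i => T (x i)) := by
  have h := hT (L.fnArity f + 1)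
    (.dist (.app f fun i => .var i.castSucc) (.var (Fin.last _))) (Fin.snoc x (E.fn f x))
  simp only [Atomic.eval, Term.eval, Fin.snoc_castSucc, Fin.snoc_last, dist_self] at h
  exact (dist_le_zero.mp h).symm

section Generated

variable (𝒜 : Set (Str.{v, u} L)) {E : Str.{v, u} L} {n : ℕ} (a : Fin n → E)

/-- `⟨a⟩`: the elements of `E` at which any two morphisms from `E` to a structure in the ambient
class `𝒜` agree as soon as they agree on the tuple `a`. -/
def gen : Set E :=
  {b | ∀ F ∈ 𝒜, ∀ f g : E → F, IsMorphism f → IsMorphism g →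
    (∀ i, f (a i) = g (a i)) → f b = g b}

theorem mem_gen (i : Fin n) : a i ∈ gen 𝒜 a := fun _ _ _ _ _ _ h => h i

theorem isClosed_gen : IsClosed (gen 𝒜 a) := by
  simp only [gen, Set.ofPred_forall]
  refine isClosed_iInter fun F => isClosed_iInter fun _ => isClosed_iInter fun f =>
    isClosed_iInter fun g => isClosed_iInter fun hf => isClosed_iInter fun hg =>
    isClosed_iInter fun _ => isClosed_eq hf.continuous hg.continuous

theorem fn_mem_gen (f : L.Fn) (x : Fin (L.fnArity f) → E) (hx : ∀ i, x i ∈ gen 𝒜 a) :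
    E.fn f x ∈ gen 𝒜 a := by
  intro F hF p q hp hq h
  rw [hp.map_fn, hq.map_fn]
  congr 1
  funext i
  exact hx i F hF p q hp hq h

/-- `⟨a⟩` as a structure, with the operations and relations of `E`. -/
def genStr : Str.{v, u} L where
  carrier := gen 𝒜 a
  metric := inferInstance
  complete := (isClosed_gen 𝒜 a).completeSpace_coe
  dist_le_one x y := E.dist_le_one x y
  fn f x := ⟨E.fn f fun i => (x i).1, fn_mem_gen 𝒜 a f _ fun i => (x i).2⟩
  fn_mod f x y := E.fn_mod f (fun i => (x i).1) (fun i => (y i).1)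
  rel R x := E.rel R fun i => (x i).1
  rel_mem R _ := E.rel_mem R _
  rel_mod R x y := E.rel_mod R (fun i => (x i).1) (fun i => (y i).1)

/-- The inclusion of `⟨a⟩` in `E`. -/
def genVal : genStr 𝒜 a → E := Subtype.val

/-- The tuple `a`, seen in `⟨a⟩`. -/
def genTuple : Fin n → genStr 𝒜 a := fun i => ⟨a i, mem_gen 𝒜 a i⟩

end Generated

/-- Finitely generated structures: those isomorphic to some `⟨a⟩`, for a finite tuple `a` in a
structure in `𝒜` (in particular every `X ∈ 𝒜` with `X = ⟨a⟩` for a finite tuple `a` in `X`). -/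
def FG (𝒜 : Set (Str.{v, u} L)) (X : Str.{v, u} L) : Prop :=
  ∃ Y ∈ 𝒜, ∃ (n : ℕ) (a : Fin n → Y) (e : X → genStr 𝒜 a),
    IsEmbedding e ∧ Function.Surjective e

/-- `(P, π)` is a product of the family `Y` in the full subcategory `𝒦`. -/
def IsProduct (𝒦 : Set (Str.{v, u} L)) {ι : Type w} (Y : ι → Str.{v, u} L) (P : Str.{v, u} L)
    (π : ∀ i, P → Y i) : Prop :=
  P ∈ 𝒦 ∧ (∀ i, IsMorphism (π i)) ∧
    ∀ Z ∈ 𝒦, ∀ f : ∀ i, Z → Y i, (∀ i, IsMorphism (f i)) →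
      ∃! h : Z → P, IsMorphism h ∧ ∀ i z, π i (h z) = f i z

/-- `(X, j)` is the inductive limit of the directed system `(Y, t)` of structures and embeddings:
the completion of the union of the system. -/
structure IsInductiveLimit {ι : Type u} [Preorder ι] (Y : ι → Str.{v, u} L)
    (t : ∀ i k, i ≤ k → Y i → Y k) (X : Str.{v, u} L) (j : ∀ i, Y i → X) : Prop where
  conn_embedding : ∀ i k h, IsEmbedding (t i k h)
  conn_refl : ∀ i y, t i i le_rfl y = y
  conn_trans : ∀ i k l (h : i ≤ k) (h' : k ≤ l) y, t k l h' (t i k h y) = t i l (h.trans h') y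
  embedding : ∀ i, IsEmbedding (j i)
  compat : ∀ i k h y, j k (t i k h y) = j i y
  dense : Dense (⋃ i, Set.range (j i))

/-- `A₀` is an initial object of the full subcategory `𝒦`. -/
def IsInitialObject (𝒦 : Set (Str.{v, u} L)) (A₀ : Str.{v, u} L) : Prop :=
  A₀ ∈ 𝒦 ∧ ∀ X ∈ 𝒦, ∃! i : A₀ → X, IsMorphism i

/-- The requirements on a class `𝒦 ⊆ 𝒜` common to the ambient class and to its strata. -/
structure BaseConditions (𝒜 𝒦 : Set (Str.{v, u} L)) : Prop where
  mem_iff : ∀ X : Str.{v, u} L, X ∈ 𝒦 ↔ ∀ (n : ℕ) (a : Fin n → X), genStr 𝒜 a ∈ 𝒦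
  limit_mem : ∀ {ι : Type u} [Preorder ι] [Nonempty ι] [IsDirectedOrder ι]
    (Y : ι → Str.{v, u} L) (t : ∀ i k, i ≤ k → Y i → Y k) (X : Str.{v, u} L) (j : ∀ i, Y i → X),
    (∀ i, Y i ∈ 𝒦) → IsInductiveLimit Y t X j → X ∈ 𝒦
  initial : ∃ A₀ : Str.{v, u} L, FG 𝒜 A₀ ∧ IsInitialObject 𝒦 A₀

/-- A collection `B` of tuples in `X` being given, `D` is fundamental in `X`: it generates a dense
substructure, and the tuples of `B` from `D` are dense among all tuples of `B`. -/
def IsFundamental (𝒜 : Set (Str.{v, u} L)) (X : Str.{v, u} L) (B : ∀ n, Set (Fin n → X))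
    (D : Set X) : Prop :=
  Dense {x : X | ∃ (n : ℕ) (a : Fin n → X), (∀ i, a i ∈ D) ∧ x ∈ gen 𝒜 a} ∧
    ∀ n, ∀ a ∈ B n, ∀ ε > 0, ∃ b ∈ B n, (∀ i, b i ∈ D) ∧ dist a b < ε

/-- The requirements on the basic tuples `B X n` of the structures `X` in `𝒦`. -/
structure IsBasicSystem (𝒜 𝒦 : Set (Str.{v, u} L))
    (B : ∀ (X : Str.{v, u} L) (n : ℕ), Set (Fin n → X)) : Prop where
  distinct : ∀ X ∈ 𝒦, ∀ n, ∀ a ∈ B X n, Function.Injective a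
  generating : ∀ X ∈ 𝒦, FG 𝒜 X → ∃ n, ∃ a ∈ B X n, gen 𝒜 a = Set.univ
  subtuple : ∀ X ∈ 𝒦, ∀ (n : ℕ) (a : Fin n → X),
    ∃ (m : ℕ) (s : Fin m → Fin n), StrictMono s ∧ a ∘ s ∈ B X m
  fundamental : ∀ X ∈ 𝒦, TopologicalSpace.SeparableSpace X →
    ∃ D : Set X, D.Countable ∧ IsFundamental 𝒜 X (B X) D
  perturbation : ∀ X ∈ 𝒦, ∀ n, ∀ a ∈ B X n, ∃ (δ₀ : ℝ≥0) (ρ : ℝ≥0 → ℝ≥0), 0 < δ₀ ∧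
    StrictMonoOn ρ (Set.Iio δ₀) ∧ ρ 0 = 0 ∧ ContinuousAt ρ 0 ∧
    ∀ Y ∈ 𝒦, ∀ f g : X → Y, IsMorphism f → IsMorphism g → ∀ δ < δ₀,
      nndist (f ∘ a) (g ∘ a) ≤ δ →
      ∃ h : genStr 𝒜 (f ∘ a) → Y, IsMorphism h ∧
        ∀ x ∈ gen 𝒜 a, ∀ z : genStr 𝒜 (f ∘ a), genVal 𝒜 (f ∘ a) z = f x →
          nndist (h z) (g x) ≤ ρ δ

/-- The full list of requirements, satisfied by the strata. Products are over nonempty families. -/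
structure FullConditions (𝒜 𝒦 : Set (Str.{v, u} L)) : Prop extends BaseConditions 𝒜 𝒦 where
  products : ∀ {ι : Type u} [Nonempty ι] (Y : ι → Str.{v, u} L), (∀ i, Y i ∈ 𝒦) →
    ∃ (P : Str.{v, u} L) (π : ∀ i, P → Y i), IsProduct 𝒦 Y P π
  product_sup : ∀ {ι : Type u} [Nonempty ι] (Y : ι → Str.{v, u} L), (∀ i, Y i ∈ 𝒦) →
    ∀ (P : Str.{v, u} L) (π : ∀ i, P → Y i), IsProduct 𝒦 Y P π →
    ∀ X ∈ 𝒦, ∀ (f : ∀ i, X → Y i) (h : X → P), (∀ i, IsMorphism (f i)) → IsMorphism h →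
      (∀ i x, π i (h x) = f i x) →
      ∀ (n : ℕ) (φ : Atomic L (Fin n)) (a : Fin n → X),
        IsLUB (Set.range fun i => φ.eval (Y i) (fun k => f i (a k)))
          (φ.eval P (fun k => h (a k)))
  product_max : ∀ Y : Bool → Str.{v, u} L, (∀ i, Y i ∈ 𝒦) →
    ∀ (Z : Str.{v, u} L) (π : ∀ i, Z → Y i), IsProduct 𝒦 Y Z π →
    ∀ A ∈ 𝒦, ∀ (n : ℕ) (fX : Fin n → A → Y false) (fY : Fin n → A → Y true) (f : Fin n → A → Z),
      (∀ k, IsMorphism (fX k)) → (∀ k, IsMorphism (fY k)) → (∀ k, IsMorphism (f k)) →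
      (∀ k x, π false (f k x) = fX k x) → (∀ k x, π true (f k x) = fY k x) →
      ∀ (m : ℕ) (φ : Atomic L (Fin n × Fin m)) (a : Fin m → A),
        φ.eval Z (fun p => f p.1 (a p.2)) ≤
          max (φ.eval (Y false) (fun p => fX p.1 (a p.2)))
            (φ.eval (Y true) (fun p => fY p.1 (a p.2)))
  totally_bounded : ∀ A ∈ 𝒦, ∀ B ∈ 𝒦, FG 𝒜 A → FG 𝒜 B → ∀ ε : ℝ≥0∞, 0 < ε →
    ∃ S : Set (A → B), S.Finite ∧ (∀ g ∈ S, IsMorphism g) ∧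
      ∀ f : A → B, IsMorphism f → ∃ g ∈ S, unifDist f g < ε
  basic : ∃ B : ∀ (X : Str.{v, u} L) (n : ℕ), Set (Fin n → X), IsBasicSystem 𝒜 𝒦 B

/-- Injective objects of the full subcategory `𝒦`: morphisms extend along embeddings. -/
def IsInjective (𝒦 : Set (Str.{v, u} L)) (A : Str.{v, u} L) : Prop :=
  A ∈ 𝒦 ∧ ∀ X ∈ 𝒦, ∀ Y ∈ 𝒦, ∀ (i : X → Y) (f : X → A), IsEmbedding i → IsMorphism f →
    ∃ g : Y → A, IsMorphism g ∧ ∀ x, g (i x) = f x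

/-- `𝒦` has enough injectives from `ℐ` with modulus `ϖ`. -/
structure EnoughInjectives (𝒜 𝒦 ℐ : Set (Str.{v, u} L)) (ϖ : ℝ≥0 → ℝ≥0) : Prop where
  approx : ∀ X ∈ 𝒦, FG 𝒜 X → ∀ ε : ℝ≥0∞, 0 < ε →
    ∃ A ∈ ℐ, ∃ (n : ℕ) (a : Fin n → A), ghDist X (genStr 𝒜 a) < ε
  extend : ∀ X ∈ 𝒦, ∀ X' ∈ 𝒦, ∀ A ∈ ℐ, FG 𝒜 X → TopologicalSpace.SeparableSpace X →
    TopologicalSpace.SeparableSpace X' → TopologicalSpace.SeparableSpace A →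
    ∀ (φ : X → X') (f : X → A) (δ : ℝ≥0), IsMorphism φ → IsMorphism f → distortion φ ≤ δ →
      ∃ h : X' → A, IsMorphism h ∧ unifDist (h ∘ φ) f ≤ ϖ δ

/-- A modulus: strictly increasing, vanishing at `0` and continuous at `0`. -/
def IsModulus (ϖ : ℝ≥0 → ℝ≥0) : Prop :=
  StrictMono ϖ ∧ ϖ 0 = 0 ∧ ContinuousAt ϖ 0

/-- A stratified Fraïssé class generated by injective objects: the ambient class `𝒜`, its strata
`𝒜q q`, the countable collections `ℐq q` of injective structures, and a cofinal collection `ℐ` in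
their union `ℐ_∞`. The distortion of a morphism from the initial object is taken to be a (finite)
number; this is automatic if the ranges of the relation symbols are uniformly bounded. -/
structure IsStratifiedClass (𝒜 : Set (Str.{v, u} L)) (𝒜q ℐq : ℕ → Set (Str.{v, u} L))
    (ℐ : Set (Str.{v, u} L)) (ϖ : ℝ≥0 → ℝ≥0) : Prop where
  modulus : IsModulus ϖ
  stratum_subset : ∀ q, 𝒜q q ⊆ 𝒜
  stratum_mono : ∀ q, 𝒜q q ⊆ 𝒜q (q + 1)
  inj_countable : ∀ q, (ℐq q).Countable
  inj_mono : ∀ q, ℐq q ⊆ ℐq (q + 1)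
  inj_separable : ∀ q, ∀ A ∈ ℐq q, TopologicalSpace.SeparableSpace A
  inj_injective : ∀ q, ∀ A ∈ ℐq q, IsInjective (𝒜q q) A
  inj_products : ∀ q, ∀ Y : Bool → Str.{v, u} L, (∀ i, Y i ∈ ℐq q) →
    ∃ P ∈ ℐq q, ∃ π : ∀ i, P → Y i, IsProduct (𝒜q q) Y P π
  cofinal_subset : ℐ ⊆ ⋃ q, ℐq q
  cofinal : ∀ B ∈ ⋃ q, ℐq q, ∃ A ∈ ℐ, ∃ i : B → A, IsEmbedding i
  base : BaseConditions 𝒜 𝒜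
  initial_finite : ∀ A₀, IsInitialObject 𝒜 A₀ → ∀ X ∈ 𝒜, ∀ i : A₀ → X, IsMorphism i →
    distortion i < ⊤
  finite_products : ∀ Y : Bool → Str.{v, u} L, (∀ i, Y i ∈ 𝒜) →
    ∃ (P : Str.{v, u} L) (π : ∀ i, P → Y i), IsProduct 𝒜 Y P π
  strata : ∀ q, FullConditions 𝒜 (𝒜q q)
  strata_enough : ∀ q, EnoughInjectives 𝒜 (𝒜q q) (ℐq q) ϖ
  enough : EnoughInjectives 𝒜 𝒜 (⋃ q, ℐq q) ϖ

/-- `M` is the Fraïssé limit of the finitely generated structures in `𝒜`: a separable structure in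
`𝒜` with the approximate extension property with modulus `ϖ`. -/
def IsFraisseLimit (𝒜 : Set (Str.{v, u} L)) (ϖ : ℝ≥0 → ℝ≥0) (M : Str.{v, u} L) : Prop :=
  M ∈ 𝒜 ∧ TopologicalSpace.SeparableSpace M ∧
    ∀ E ∈ 𝒜, ∀ F ∈ 𝒜, FG 𝒜 E → FG 𝒜 F →
    ∀ (φ : E → F) (f : E → M) (δ ε : ℝ≥0), 0 < δ → 0 < ε → IsMorphism φ → IsMorphism f →
      distortion φ < δ → distortion f < δ →
      ∃ g : F → M, IsMorphism g ∧ distortion g < ε ∧ unifDist (g ∘ φ) f < ϖ δ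

/-- Approximate injectivity: morphisms to `X` from `⟨a⟩`, for a finite tuple `a` in a structure
`A ∈ ℐ`, extend to `A` up to an arbitrarily small error on `a`. -/
def IsApproxInjective (𝒜 ℐ : Set (Str.{v, u} L)) (X : Str.{v, u} L) : Prop :=
  ∀ A ∈ ℐ, ∀ (n : ℕ) (a : Fin n → A) (f : genStr 𝒜 a → X), IsMorphism f → ∀ ε : ℝ, 0 < ε →
    ∃ g : A → X, IsMorphism g ∧ dist (g ∘ a) (f ∘ genTuple 𝒜 a) ≤ ε

end MetricFraisse

/-! The members of $\mathcal{I}_\infty$ are exactly injective for separable structures: extension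
with modulus `ϖ` along a map of distortion $0$ has error `ϖ 0 = 0`. On any finite tuple the identity
of $M$, and that of a separable approximately injective $X$, approximately factors through a member
of $\mathcal{I}_\infty$ (`exists_factor_limit`, `exists_factor_approxInjective`). For $M$ the way
back is an embedding, supplied by `IsFraisseLimit.exists_isEmbedding`; for $X$ it comes from
approximate injectivity.

If $X$ is approximately injective, maps $\eta:X\to M$ and $\tau:M\to X$ with $\tau\eta=\mathrm{id}$
arise as limits of pairs $(j,r)$ with $rj$ ever closer to the identity on longer initial segments of
a dense sequence. The core is one improvement step, `exists_better_pair`. Let $\mathrm{id}_M\approx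
sp$ through $A$ and $\mathrm{id}_X\approx s'p'$ through $C$ on the relevant tuples, and let
$P=A\times C$ in a common stratum. Put $l=(\mathrm{id},\,p'rs):A\to P$ and
$k=(pjs',\,\mathrm{id}):C\to P$. The first coordinate of $lp$ is $p$, so $lp$ has small distortion
and some embedding $G:P\to M$ almost inverts it. With $h:M\to P$ undoing $G$ on a finite tuple, set
$j'=Gkp'$ and $r'=s'\pi_2h$. Then $r'j'=s'p'\approx\mathrm{id}$ on the new tuple in $X$, and
$r'\approx s'\pi_2lp=s'p'rsp\approx r$ on the prescribed tuple in $M$. Moreover $j'$ is close to $j$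
on the old tuple, because the metric on morphisms into $P$ is controlled by the two coordinates.

Conversely, a morphism $f:\langle a\rangle\to X$ into a retract of $M$ is pushed into $M$, then into
some $B\in\mathcal{I}_\infty$ through which $\mathrm{id}_M$ almost factors; there it extends exactly
to $A$, and the extension is carried back to $X$. -/

namespace MetricFraisse

universe v u w

variable {L : Language.{v}}

/-! ### Morphisms, embeddings and distortion -/

section Basic

variable {E F G : Str.{v, u} L}

theorem IsEmbedding.isMorphism {T : E → F} (hT : IsEmbedding T) : IsMorphism T :=
  fun n φ a => (hT n φ a).le

theorem IsMorphism.comp {S : F → G} {T : E → F} (hS : IsMorphism S) (hT : IsMorphism T) :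
    IsMorphism (S ∘ T) :=
  fun n φ a => (hS n φ fun i => T (a i)).trans (hT n φ a)

theorem isMorphism_id : IsMorphism (id : E → E) := fun _ _ _ => le_rfl

theorem IsEmbedding.comp {S : F → G} {T : E → F} (hS : IsEmbedding S) (hT : IsEmbedding T) :
    IsEmbedding (S ∘ T) :=
  fun n φ a => (hS n φ fun i => T (a i)).trans (hT n φ a)

/-- A map is a morphism if its composition with an embedding is one. -/
theorem IsEmbedding.isMorphism_of_comp {S : F → G} {T : E → F} (hS : IsEmbedding S)
    (hT : IsMorphism (S ∘ T)) : IsMorphism T :=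
  fun n φ a => (hS n φ fun i => T (a i)).symm.le.trans (hT n φ a)

/-- A morphism with a left inverse that is a morphism is an embedding. -/
theorem IsMorphism.isEmbedding_of_leftInverse {T : E → F} {S : F → E} (hT : IsMorphism T)
    (hS : IsMorphism S) (h : ∀ x, S (T x) = x) : IsEmbedding T := by
  refine fun n φ a => le_antisymm (hT n φ a) ?_
  simpa only [h] using hS n φ fun i => T (a i)

theorem IsEmbedding.distortion_eq_zero {T : E → F} (hT : IsEmbedding T) : distortion T = 0 := by
  simp only [distortion, hT _ _ _, sub_self, abs_zero, ENNReal.ofReal_zero, ENNReal.iSup_zero]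

theorem IsEmbedding.distortion_comp {S : F → G} {T : E → F} (hS : IsEmbedding S) :
    distortion (S ∘ T) = distortion T := by
  refine iSup_congr fun n => iSup_congr fun φ => iSup_congr fun a => ?_
  rw [← hS n φ fun i => T (a i)]
  rfl

/-- Morphisms only decrease atomic formulas, so the losses of `T` and `S` add up and cannot cancel.
-/
theorem distortion_le_comp {S : F → G} {T : E → F} (hS : IsMorphism S) (hT : IsMorphism T) :
    distortion T ≤ distortion (S ∘ T) := by
  refine iSup_mono fun n => iSup_mono fun φ => iSup_mono fun a => ENNReal.ofReal_le_ofReal ?_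
  have h₁ := hT n φ a
  have h₂ := hS n φ fun i => T (a i)
  rw [abs_of_nonneg (sub_nonneg.2 h₁)]
  exact (sub_le_sub_left h₂ _).trans (le_abs_self _)

theorem abs_eval_sub_le {T : E → F} {δ : ℝ≥0} (h : distortion T ≤ δ) {n : ℕ}
    (φ : Atomic L (Fin n)) (a : Fin n → E) :
    |φ.eval E a - φ.eval F fun i => T (a i)| ≤ δ := by
  have h₁ : ENNReal.ofReal |φ.eval E a - φ.eval F fun i => T (a i)| ≤ distortion T :=
    le_iSup_of_le n (le_iSup_of_le φ (le_iSup_of_le a le_rfl))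
  have h₂ := h₁.trans h
  rwa [← ENNReal.ofReal_coe_nnreal, ENNReal.ofReal_le_ofReal_iff δ.coe_nonneg] at h₂

theorem dist_le_of_unifDist_le {S T : E → F} {c : ℝ≥0} (h : unifDist S T ≤ c) (x : E) :
    dist (S x) (T x) ≤ c := by
  have h₁ : edist (S x) (T x) ≤ c := (le_iSup (fun x => edist (S x) (T x)) x).trans h
  rw [edist_nndist] at h₁
  exact_mod_cast h₁

theorem exists_of_ghDist_lt {ε : ℝ≥0∞} (h : ghDist E F < ε) :
    ∃ (f : E → F) (g : F → E), IsMorphism f ∧ IsMorphism g ∧ unifDist (g ∘ f) id < ε ∧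
      distortion f < ε := by
  obtain ⟨ε', ⟨-, f, g, hf, hg, h₁, -, h₂, -⟩, hε⟩ := sInf_lt_iff.1 h
  exact ⟨f, g, hf, hg, h₁.trans hε, h₂.trans hε⟩

end Basic

/-! ### Continuity of formulas; morphisms determined on dense families -/

section Continuity

variable {X Y : Str.{v, u} L}

theorem continuous_of_modulus {α β : Type*} [PseudoMetricSpace α] [PseudoMetricSpace β]
    {f : α → β} {ω : ℝ≥0 → ℝ≥0} (h0 : ω 0 = 0) (hω : ContinuousAt ω 0)
    (h : ∀ x y, nndist (f x) (f y) ≤ ω (nndist x y)) : Continuous f := by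
  refine continuous_iff_continuousAt.2 fun x => ?_
  rw [ContinuousAt, tendsto_iff_dist_tendsto_zero]
  have h₁ : Filter.Tendsto (fun y => ω (nndist y x)) (nhds x) (nhds 0) := by
    have h₂ : Filter.Tendsto (fun y => nndist y x) (nhds x) (nhds 0) := by
      have : Continuous fun y => nndist y x := by fun_prop
      simpa using this.tendsto x
    have h₃ : Filter.Tendsto ω (nhds 0) (nhds 0) := by simpa [ContinuousAt, h0] using hω
    exact h₃.comp h₂
  refine squeeze_zero (fun _ => dist_nonneg) (fun y => ?_) (NNReal.tendsto_coe.2 h₁)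
  exact_mod_cast h y x

theorem Str.continuous_fn (X : Str.{v, u} L) (f : L.Fn) : Continuous (X.fn f) :=
  continuous_of_modulus (L.fnMod_zero f) (L.fnMod_cont f) (X.fn_mod f)

theorem Str.continuous_rel (X : Str.{v, u} L) (R : L.Rel) : Continuous (X.rel R) :=
  continuous_of_modulus (L.relMod_zero R) (L.relMod_cont R) (X.rel_mod R)

theorem Term.continuous_eval {α : Type w} (X : Str.{v, u} L) (t : Term L α) :
    Continuous fun a : α → X => t.eval X a := by
  induction t with
  | var i => exact continuous_apply i
  | app f ts ih => exact (X.continuous_fn f).comp (continuous_pi ih)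

theorem Atomic.continuous_eval {α : Type w} (X : Str.{v, u} L) (φ : Atomic L α) :
    Continuous fun a : α → X => φ.eval X a := by
  cases φ with
  | dist s t => exact (s.continuous_eval X).dist (t.continuous_eval X)
  | rel R ts => exact (X.continuous_rel R).comp (continuous_pi fun k => (ts k).continuous_eval X)

/-- An assignment on a dense family that does not increase atomic formulas extends to a
morphism. -/
theorem exists_isMorphism_of_denseRange {ι : Type w} {b : ι → X} (hb : DenseRange b) (m : ι → Y)
    (h : ∀ (n : ℕ) (φ : Atomic L (Fin n)) (i : Fin n → ι),
      φ.eval Y (fun k => m (i k)) ≤ φ.eval X fun k => b (i k)) :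
    ∃ G : X → Y, IsMorphism G ∧ ∀ i, G (b i) = m i := by
  have hd : ∀ i k, dist (m i) (m k) ≤ dist (b i) (b k) := fun i k => by
    simpa [Atomic.eval, Term.eval] using h 2 (.dist (.var 0) (.var 1)) ![i, k]
  have hex : ∀ x, ∃ k : ℕ → ι, Filter.Tendsto (fun n => b (k n)) Filter.atTop (nhds x) := by
    intro x
    obtain ⟨s, hs, hx⟩ := mem_closure_iff_seq_limit.1 (hb x)
    choose k hk using hs
    exact ⟨k, by simpa only [hk] using hx⟩
  choose k hk using hex
  have hc : ∀ x, CauchySeq fun n => m (k x n) := by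
    intro x
    have := (hk x).cauchySeq
    rw [Metric.cauchySeq_iff] at this ⊢
    intro ε hε
    obtain ⟨N, hN⟩ := this ε hε
    exact ⟨N, fun i hi l hl => (hd _ _).trans_lt (hN i hi l hl)⟩
  choose G hG using fun x => cauchySeq_tendsto_of_complete (hc x)
  refine ⟨G, fun n φ a => ?_, fun i => ?_⟩
  · have h₁ := ((φ.continuous_eval Y).tendsto _).comp
      (tendsto_pi_nhds.2 fun l => hG (a l))
    have h₂ := ((φ.continuous_eval X).tendsto _).comp
      (tendsto_pi_nhds.2 fun l => hk (a l))
    exact le_of_tendsto_of_tendsto' h₁ h₂ fun N => h n φ fun l => k (a l) N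
  · refine tendsto_nhds_unique (hG (b i)) ?_
    rw [tendsto_iff_dist_tendsto_zero]
    exact squeeze_zero (fun _ => dist_nonneg) (fun n => hd _ _)
      (tendsto_iff_dist_tendsto_zero.1 (hk (b i)))

theorem isEmbedding_of_denseRange {ι : Type w} {b : ι → X} (hb : DenseRange b) {G : X → Y}
    (hG : IsMorphism G)
    (h : ∀ (n : ℕ) (φ : Atomic L (Fin n)) (i : Fin n → ι),
      φ.eval Y (fun k => G (b (i k))) = φ.eval X fun k => b (i k)) : IsEmbedding G := by
  intro n φ a
  have hd : DenseRange (Pi.map fun _ : Fin n => b) := DenseRange.piMap fun _ => hb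
  refine congrFun (hd.equalizer (g := fun a : Fin n → X => φ.eval Y fun k => G (a k))
    (h := fun a => φ.eval X a) ?_ (φ.continuous_eval X) (funext fun i => h n φ i)) a
  exact (φ.continuous_eval Y).comp
    (continuous_pi fun k => hG.continuous.comp (continuous_apply k))

/-- A sequence of morphisms converging on a dense family converges pointwise to a morphism. -/
theorem exists_tendsto_isMorphism {f : ℕ → X → Y} (hf : ∀ n, IsMorphism (f n)) {ι : Type w}
    {b : ι → X} (hb : DenseRange b) (hc : ∀ i, CauchySeq fun n => f n (b i)) :
    ∃ G : X → Y, IsMorphism G ∧ ∀ x, Filter.Tendsto (fun n => f n x) Filter.atTop (nhds (G x)) := by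
  have hall : ∀ x, CauchySeq fun n => f n x := by
    intro x
    rw [Metric.cauchySeq_iff]
    intro ε hε
    obtain ⟨i, hi⟩ := hb.exists_dist_lt x (ε := ε / 3) (by positivity)
    obtain ⟨N, hN⟩ := Metric.cauchySeq_iff.1 (hc i) (ε / 3) (by positivity)
    refine ⟨N, fun k hk l hl => ?_⟩
    have h₁ := (hf k).dist_le x (b i)
    have h₂ := (hf l).dist_le x (b i)
    have h₃ := hN k hk l hl
    have h₄ := dist_triangle4 (f k x) (f k (b i)) (f l (b i)) (f l x)
    rw [dist_comm (f l (b i))] at h₄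
    linarith
  choose G hG using fun x => cauchySeq_tendsto_of_complete (hall x)
  refine ⟨G, fun n φ a => ?_, hG⟩
  exact le_of_tendsto' (((φ.continuous_eval Y).tendsto _).comp
    (tendsto_pi_nhds.2 fun l => hG (a l))) fun N => hf N n φ a

end Continuity

/-! ### The substructures $\langle\bar a\rangle$ -/

section Generated

variable {𝒜 : Set (Str.{v, u} L)} {E F : Str.{v, u} L} {n m : ℕ}

theorem Term.eval_map {E F : Str.{v, u} L} {T : E → F}
    (hT : ∀ f x, T (E.fn f x) = F.fn f fun i => T (x i)) {α : Type w} (t : Term L α) (a : α → E) :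
    T (t.eval E a) = t.eval F fun i => T (a i) := by
  induction t with
  | var i => rfl
  | app f ts ih => simp only [Term.eval, hT, ih]

theorem isEmbedding_genVal (a : Fin n → E) : IsEmbedding (genVal 𝒜 a) := by
  intro k φ b
  have ht : ∀ t : Term L (Fin k), genVal 𝒜 a (t.eval _ b) = t.eval E fun i => genVal 𝒜 a (b i) :=
    fun t => t.eval_map (fun _ _ => rfl) b
  cases φ with
  | dist s t =>
    simp only [Atomic.eval, ← ht]
    rfl
  | rel R ts =>
    simp only [Atomic.eval, ← ht]
    rfl

theorem gen_subset_gen {a : Fin n → E} {b : Fin m → E} (h : ∀ i, a i ∈ gen 𝒜 b) :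
    gen 𝒜 a ⊆ gen 𝒜 b :=
  fun _ hx F hF f g hf hg hfg => hx F hF f g hf hg fun i => h i F hF f g hf hg hfg

theorem IsMorphism.map_mem_gen {T : E → F} (hT : IsMorphism T) {a : Fin n → E} {x : E}
    (hx : x ∈ gen 𝒜 a) : T x ∈ gen 𝒜 (T ∘ a) :=
  fun G hG _ _ hf hg hfg => hx G hG _ _ (hf.comp hT) (hg.comp hT) hfg

/-- A map from `E` to `F` sending `a` into `⟨b⟩` restricts to a morphism from `⟨a⟩` to `⟨b⟩`. -/
theorem IsMorphism.exists_genMap {T : E → F} (hT : IsMorphism T) {a : Fin n → E} {b : Fin m → F}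
    (h : ∀ i, T (a i) ∈ gen 𝒜 b) :
    ∃ S : genStr 𝒜 a → genStr 𝒜 b, IsMorphism S ∧ genVal 𝒜 b ∘ S = T ∘ genVal 𝒜 a := by
  refine ⟨fun x => ⟨T x.1, gen_subset_gen h (hT.map_mem_gen x.2)⟩, ?_, rfl⟩
  exact (isEmbedding_genVal b).isMorphism_of_comp (hT.comp (isEmbedding_genVal a).isMorphism)

theorem fg_genStr {X : Str.{v, u} L} (hX : X ∈ 𝒜) (a : Fin n → X) : FG 𝒜 (genStr 𝒜 a) :=
  ⟨X, hX, n, a, id, fun _ _ _ => rfl, Function.surjective_id⟩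

theorem separableSpace_genStr (hE : TopologicalSpace.SeparableSpace E) (a : Fin n → E) :
    TopologicalSpace.SeparableSpace (genStr 𝒜 a) := by
  have := UniformSpace.secondCountable_of_separable E
  have : SecondCountableTopology (gen 𝒜 a) := inferInstance
  exact inferInstanceAs (TopologicalSpace.SeparableSpace (gen 𝒜 a))

/-- A separable structure is exhausted by an increasing sequence of structures `⟨t n⟩`, starting
above a given `⟨a⟩`. -/
theorem exists_exhaustion (hE : TopologicalSpace.SeparableSpace E) (a : Fin n → E) :
    ∃ (k : ℕ → ℕ) (t : ∀ N, Fin (k N) → E), (∀ i, a i ∈ gen 𝒜 (t 0)) ∧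
      (∀ N i, t N i ∈ gen 𝒜 (t (N + 1))) ∧ Dense (⋃ N, gen 𝒜 (t N)) := by
  rcases isEmpty_or_nonempty E with hempty | hne
  · exact ⟨fun _ => n, fun _ => a, mem_gen 𝒜 a, fun _ => mem_gen 𝒜 a, fun x => isEmptyElim x⟩
  · set d := TopologicalSpace.denseSeq E with hd
    -- `t N` lists `a` followed by the first `N` terms of the dense sequence, so `t 0` is just `a`.
    let t : ∀ N, Fin (n + N) → E := fun N => Fin.append a fun i => d i
    have h₁ : ∀ N i, a i ∈ gen 𝒜 (t N) := fun N i => by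
      simpa [t] using mem_gen 𝒜 (t N) (Fin.castAdd N i)
    have h₂ : ∀ N i, i < N → d i ∈ gen 𝒜 (t N) := fun N i hi => by
      simpa only [t, Fin.append_right] using mem_gen 𝒜 (t N) (Fin.natAdd n ⟨i, hi⟩)
    refine ⟨fun N => n + N, t, h₁ 0, fun N i => ?_, ?_⟩
    · refine Fin.addCases (fun i => ?_) (fun i => ?_) i
      · simpa [t] using h₁ (N + 1) i
      · simpa [t] using h₂ (N + 1) i (by omega)
    · refine (TopologicalSpace.denseRange_denseSeq E).mono ?_
      rintro _ ⟨i, rfl⟩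
      exact Set.mem_iUnion.2 ⟨i + 1, h₂ _ i (by omega)⟩

end Generated

/-- Dependent choice along a sequence of types. -/
theorem exists_seq_of_forall_exists {α : ℕ → Type w} {P : ∀ n, α n → Prop}
    {R : ∀ n, α n → α (n + 1) → Prop} (a₀ : α 0) (h₀ : P 0 a₀)
    (h : ∀ n a, P n a → ∃ b, P (n + 1) b ∧ R n a b) :
    ∃ f : ∀ n, α n, f 0 = a₀ ∧ (∀ n, P n (f n)) ∧ ∀ n, R n (f n) (f (n + 1)) := by
  choose s hs hR using h
  let f : ∀ n, {a : α n // P n a} :=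
    fun n => Nat.rec ⟨a₀, h₀⟩ (fun n a => ⟨s n a.1 a.2, hs n a.1 a.2⟩) n
  exact ⟨fun n => (f n).1, rfl, fun n => (f n).2, fun n => hR n _ _⟩

theorem IsModulus.exists_lt {ϖ : ℝ≥0 → ℝ≥0} (hϖ : IsModulus ϖ) {ε : ℝ} (hε : 0 < ε) :
    ∃ δ : ℝ≥0, 0 < δ ∧ (δ : ℝ) < ε ∧ (ϖ δ : ℝ) < ε := by
  lift ε to ℝ≥0 using hε.le
  have hε' : 0 < ε := by exact_mod_cast hε
  have h₁ : ∀ᶠ x in nhds (0 : ℝ≥0), ϖ x < ε := by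
    refine hϖ.2.2.eventually (gt_mem_nhds ?_)
    rwa [hϖ.2.1]
  obtain ⟨r, hr, h⟩ := Metric.eventually_nhds_iff.1 h₁
  lift r to ℝ≥0 using hr.le
  have hr' : 0 < r := by exact_mod_cast hr
  have h₂ : 0 < min (r / 2) (ε / 2) := lt_min (half_pos hr') (half_pos hε')
  refine ⟨min (r / 2) (ε / 2), h₂, ?_, ?_⟩
  · exact_mod_cast (min_le_right _ _).trans_lt (NNReal.half_lt_self hε'.ne')
  · have h₃ : min (r / 2) (ε / 2) < r :=
      (min_le_left _ _).trans_lt (NNReal.half_lt_self hr'.ne')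
    have := h (y := min (r / 2) (ε / 2)) (by
      rw [NNReal.dist_eq, NNReal.coe_zero, sub_zero, abs_of_nonneg (NNReal.coe_nonneg _)]
      exact_mod_cast h₃)
    exact_mod_cast this

/-! ### Embeddings into the Fraïssé limit -/

section Limit

variable {𝒜 : Set (Str.{v, u} L)} {ϖ : ℝ≥0 → ℝ≥0} {M : Str.{v, u} L}

/-- A sequence of approximate embeddings into `M` of the structures `⟨t N⟩` exhausting `B`, each
approximately extending the previous one, converges to an embedding of `B` into `M`. -/
theorem exists_isEmbedding_of_exhaustion {B : Str.{v, u} L} {k : ℕ → ℕ} {t : ∀ N, Fin (k N) → B}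
    (ht : ∀ N i, t N i ∈ gen 𝒜 (t (N + 1))) (hdense : Dense (⋃ N, gen 𝒜 (t N)))
    {δ : ℕ → ℝ≥0} (hδ : Filter.Tendsto δ Filter.atTop (nhds 0)) {ε : ℝ} (hε : 0 < ε)
    (g : ∀ N, genStr 𝒜 (t N) → M) (hgδ : ∀ N, distortion (g N) ≤ δ N)
    (hgg : ∀ N x (h : x ∈ gen 𝒜 (t N)) (h' : x ∈ gen 𝒜 (t (N + 1))),
      dist (g N ⟨x, h⟩) (g (N + 1) ⟨x, h'⟩) ≤ ε / 2 / 2 ^ N) :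
    ∃ G : B → M, IsEmbedding G ∧ ∀ x (h : x ∈ gen 𝒜 (t 0)), dist (G x) (g 0 ⟨x, h⟩) ≤ ε := by
  have hmono : Monotone fun N => gen 𝒜 (t N) :=
    monotone_nat_of_le_succ fun N => gen_subset_gen (ht N)
  -- The increments from index `N` on are at most `ε / 2 / 2 ^ l`, with sum `ε`. Convergence is
  -- stated for all late `l` with any proof of membership, so that it does not depend on `N`.
  have hlim : ∀ N x (h : x ∈ gen 𝒜 (t N)), ∃ m : M,
      (∀ ε' > 0, ∃ K, ∀ l ≥ K, ∀ h : x ∈ gen 𝒜 (t l), dist (g l ⟨x, h⟩) m < ε') ∧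
        dist (g N ⟨x, h⟩) m ≤ ε := by
    intro N x h
    have hu : ∀ l, dist (g (N + l) ⟨x, hmono (Nat.le_add_right N l) h⟩)
        (g (N + (l + 1)) ⟨x, hmono (Nat.le_add_right N (l + 1)) h⟩) ≤ ε / 2 / 2 ^ l := by
      intro l
      refine (hgg (N + l) x _ _).trans ?_
      gcongr
      · norm_num
      · omega
    obtain ⟨m, hm⟩ := cauchySeq_tendsto_of_complete (cauchySeq_of_le_geometric_two hu)
    refine ⟨m, fun ε' hε' => ?_, dist_le_of_le_geometric_two_of_tendsto₀ hu hm⟩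
    obtain ⟨K, hK⟩ := Metric.tendsto_atTop.1 hm ε' hε'
    refine ⟨N + K, fun l hl hx => ?_⟩
    obtain ⟨j, rfl⟩ := Nat.exists_eq_add_of_le ((Nat.le_add_right N K).trans hl)
    exact hK j (by omega)
  have hlim' : ∀ x : ↥(⋃ N, gen 𝒜 (t N)), ∃ m : M,
      (∀ ε' > 0, ∃ K, ∀ l ≥ K, ∀ h : x.1 ∈ gen 𝒜 (t l), dist (g l ⟨x.1, h⟩) m < ε') ∧
        ∀ h : x.1 ∈ gen 𝒜 (t 0), dist (g 0 ⟨x.1, h⟩) m ≤ ε := by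
    rintro ⟨x, hx⟩
    -- Starting at index `0` whenever possible makes the total error `ε` refer to `g 0`.
    by_cases h0 : x ∈ gen 𝒜 (t 0)
    · obtain ⟨m, hm, hm'⟩ := hlim 0 x h0
      exact ⟨m, hm, fun _ => hm'⟩
    · obtain ⟨N, hN⟩ := Set.mem_iUnion.1 hx
      obtain ⟨m, hm, -⟩ := hlim N x hN
      exact ⟨m, hm, fun h => absurd h h0⟩
  choose m hm hm₀ using hlim'
  have hdr : DenseRange (Subtype.val : ↥(⋃ N, gen 𝒜 (t N)) → B) := hdense.denseRange_val
  have heq : ∀ (n : ℕ) (φ : Atomic L (Fin n)) (i : Fin n → ↥(⋃ N, gen 𝒜 (t N))),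
      φ.eval M (fun k => m (i k)) = φ.eval B fun k => (i k).1 := by
    intro n φ i
    choose N hN using fun k => Set.mem_iUnion.1 (i k).2
    set K := Finset.univ.sup N with hK
    have hmem : ∀ l k, (i k).1 ∈ gen 𝒜 (t (K + l)) := fun l k =>
      hmono ((Finset.le_sup (Finset.mem_univ k)).trans (Nat.le_add_right K l)) (hN k)
    have h₁ : Filter.Tendsto (fun l => φ.eval M fun k => g (K + l) ⟨(i k).1, hmem l k⟩)
        Filter.atTop (nhds (φ.eval M fun k => m (i k))) := by
      refine ((φ.continuous_eval M).tendsto _).comp (tendsto_pi_nhds.2 fun k => ?_)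
      refine Metric.tendsto_atTop.2 fun ε' hε' => ?_
      obtain ⟨K', hK'⟩ := hm (i k) ε' hε'
      exact ⟨K', fun l hl => hK' (K + l) (by omega) _⟩
    -- The distortions `δ (K + l)` tend to `0`, so in the limit the values of formulas are preserved
    -- exactly.
    have h₂ : Filter.Tendsto (fun l => φ.eval M fun k => g (K + l) ⟨(i k).1, hmem l k⟩)
        Filter.atTop (nhds (φ.eval B fun k => (i k).1)) := by
      rw [tendsto_iff_dist_tendsto_zero]
      have hδ' : Filter.Tendsto (fun l => (δ (K + l) : ℝ)) Filter.atTop (nhds 0) := by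
        have := hδ.comp (Filter.tendsto_add_atTop_nat K)
        simpa only [Function.comp_def, add_comm, NNReal.coe_zero] using NNReal.tendsto_coe.2 this
      refine squeeze_zero (fun _ => dist_nonneg) (fun l => ?_) hδ'
      have h₃ := abs_eval_sub_le (hgδ (K + l)) φ fun k => ⟨(i k).1, hmem l k⟩
      have h₄ : φ.eval B (fun k => (i k).1) =
          φ.eval (genStr 𝒜 (t (K + l))) fun k => ⟨(i k).1, hmem l k⟩ :=
        isEmbedding_genVal (𝒜 := 𝒜) (t (K + l)) n φ fun k => ⟨(i k).1, hmem l k⟩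
      rw [dist_comm, h₄]
      exact h₃
    exact tendsto_nhds_unique h₁ h₂
  obtain ⟨G, hG, hGm⟩ := exists_isMorphism_of_denseRange hdr m fun n φ i => (heq n φ i).le
  refine ⟨G, isEmbedding_of_denseRange hdr hG fun n φ i => ?_, fun x h => ?_⟩
  · simp only [hGm, heq]
  · have := hGm ⟨x, Set.mem_iUnion.2 ⟨0, h⟩⟩
    rw [dist_comm, this]
    exact hm₀ ⟨x, _⟩ h

/-- Embedding property of the Fraïssé limit `M`: if a morphism `φ : M → B` has distortion less than
`δ` on `⟨e⟩`, then there is an embedding of `B` into `M` that almost inverts `φ` on `e`. -/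
theorem IsFraisseLimit.exists_isEmbedding (hϖ : IsModulus ϖ) (hbase : BaseConditions 𝒜 𝒜)
    (hM : IsFraisseLimit 𝒜 ϖ M) {B : Str.{v, u} L} (hB : B ∈ 𝒜)
    (hBsep : TopologicalSpace.SeparableSpace B) {n : ℕ} (e : Fin n → M) {φ : M → B}
    (hφ : IsMorphism φ) {δ : ℝ≥0} (hδ : distortion (φ ∘ genVal 𝒜 e) < δ) {ε : ℝ} (hε : 0 < ε) :
    ∃ G : B → M, IsEmbedding G ∧ ∀ i, dist (G (φ (e i))) (e i) ≤ ϖ δ + ε := by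
  obtain ⟨hMA, -, hext⟩ := hM
  obtain ⟨k, t, ht₀, ht, hdense⟩ := exists_exhaustion (𝒜 := 𝒜) hBsep (φ ∘ e)
  -- `d N` bounds the distortion of the `N`-th map, and `ϖ (d N)` the displacement caused by the
  -- next extension.
  have hex : ∀ N : ℕ, ∃ d : ℝ≥0, 0 < d ∧ (d : ℝ) < ε / 2 / 2 ^ N ∧ (ϖ d : ℝ) < ε / 2 / 2 ^ N :=
    fun N => hϖ.exists_lt (by positivity)
  choose d hd₀ hd hϖd using hex
  have hdlim : Filter.Tendsto d Filter.atTop (nhds 0) := by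
    refine NNReal.tendsto_coe.1 (squeeze_zero (fun _ => NNReal.coe_nonneg _) (fun N => (hd N).le) ?_)
    exact tendsto_const_nhds.div_atTop (tendsto_pow_atTop_atTop_of_one_lt (by norm_num))
  have hgenM : ∀ {n : ℕ} (e : Fin n → M), genStr 𝒜 e ∈ 𝒜 := (hbase.mem_iff M).1 hMA _
  have hgenB : ∀ {n : ℕ} (e : Fin n → B), genStr 𝒜 e ∈ 𝒜 := (hbase.mem_iff B).1 hB _
  obtain ⟨S, hS, hSφ⟩ := hφ.exists_genMap ht₀
  have hSδ : distortion S < δ := by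
    rwa [← (isEmbedding_genVal (𝒜 := 𝒜) (t 0)).distortion_comp, hSφ]
  have hδ₀ : 0 < δ := by exact_mod_cast (zero_le).trans_lt hδ
  -- Only this first extension costs `ϖ δ`: it extends the inclusion of `⟨e⟩` along the restriction
  -- `S` of `φ`. The later ones are along inclusions, which have distortion `0`.
  obtain ⟨g₀, hg₀, hg₀d, hg₀S⟩ := hext _ (hgenM e) _ (hgenB (t 0)) (fg_genStr hMA e)
    (fg_genStr hB (t 0)) S (genVal 𝒜 e) δ (d 0) hδ₀ (hd₀ 0) hS (isEmbedding_genVal e).isMorphism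
    hSδ (by simpa [(isEmbedding_genVal (𝒜 := 𝒜) e).distortion_eq_zero] using hδ₀)
  obtain ⟨g, rfl, hg, hgg⟩ := exists_seq_of_forall_exists
    (α := fun N => genStr 𝒜 (t N) → M) (P := fun N g => IsMorphism g ∧ distortion g < d N)
    (R := fun N g g' => ∀ x (h : x ∈ gen 𝒜 (t N)) (h' : x ∈ gen 𝒜 (t (N + 1))),
      dist (g ⟨x, h⟩) (g' ⟨x, h'⟩) ≤ ε / 2 / 2 ^ N) g₀ ⟨hg₀, hg₀d⟩ (by
    rintro N g ⟨hg, hgd⟩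
    obtain ⟨i, hi, hival⟩ := (isMorphism_id (E := B)).exists_genMap (𝒜 := 𝒜) (ht N)
    have hie : distortion i = 0 := by
      rw [← (isEmbedding_genVal (𝒜 := 𝒜) (t (N + 1))).distortion_comp, hival]
      exact (isEmbedding_genVal (t N)).distortion_eq_zero
    obtain ⟨g', hg', hgd', hgg'⟩ := hext _ (hgenB (t N)) _ (hgenB (t (N + 1)))
      (fg_genStr hB _) (fg_genStr hB _) i g (d N) (d (N + 1)) (hd₀ N) (hd₀ _) hi hg
      (by simpa [hie] using hd₀ N) hgd
    refine ⟨g', ⟨hg', hgd'⟩, fun x h h' => ?_⟩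
    have hix : i ⟨x, h⟩ = ⟨x, h'⟩ := Subtype.ext (congrFun hival ⟨x, h⟩)
    have : dist (g' (i ⟨x, h⟩)) (g ⟨x, h⟩) ≤ ϖ (d N) := dist_le_of_unifDist_le hgg'.le ⟨x, h⟩
    rw [hix, dist_comm] at this
    exact this.trans (hϖd N).le)
  obtain ⟨G, hG, hG₀⟩ := exists_isEmbedding_of_exhaustion ht hdense hdlim hε g
    (fun N => (hg N).2.le) hgg
  refine ⟨G, hG, fun i => ?_⟩
  have h₁ := hG₀ (φ (e i)) (ht₀ i)
  have h₂ := dist_le_of_unifDist_le hg₀S.le (genTuple 𝒜 e i)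
  have hSe : S (genTuple 𝒜 e i) = ⟨φ (e i), ht₀ i⟩ :=
    Subtype.ext (congrFun hSφ (genTuple 𝒜 e i))
  rw [Function.comp_apply, hSe] at h₂
  have h₃ := dist_triangle (G (φ (e i))) (g 0 ⟨φ (e i), ht₀ i⟩) (e i)
  have h₄ : dist (g 0 ⟨φ (e i), ht₀ i⟩) (e i) ≤ ϖ δ := h₂
  linarith

end Limit

/-! ### Injectivity and approximate factorization through $\mathcal{I}_\infty$ -/

section Stratified

variable {𝒜 : Set (Str.{v, u} L)} {𝒜q ℐq : ℕ → Set (Str.{v, u} L)} {ℐ : Set (Str.{v, u} L)}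
  {ϖ : ℝ≥0 → ℝ≥0} {M X : Str.{v, u} L}

namespace IsStratifiedClass

theorem mem_of_mem_inj (H : IsStratifiedClass 𝒜 𝒜q ℐq ℐ ϖ) {q : ℕ} {A : Str.{v, u} L}
    (hA : A ∈ ℐq q) : A ∈ 𝒜 :=
  H.stratum_subset q (H.inj_injective q A hA).1

theorem genStr_mem (H : IsStratifiedClass 𝒜 𝒜q ℐq ℐ ϖ) {Y : Str.{v, u} L} (hY : Y ∈ 𝒜) {n : ℕ}
    (y : Fin n → Y) : genStr 𝒜 y ∈ 𝒜 :=
  (H.base.mem_iff Y).1 hY n y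

/-- Morphisms from `⟨y⟩` to a member of `ℐ_∞` extend along embeddings of `⟨y⟩`. -/
theorem exists_extension (H : IsStratifiedClass 𝒜 𝒜q ℐq ℐ ϖ) {Y Z A : Str.{v, u} L} (hY : Y ∈ 𝒜)
    (hYsep : TopologicalSpace.SeparableSpace Y) (hZ : Z ∈ 𝒜)
    (hZsep : TopologicalSpace.SeparableSpace Z) {q : ℕ} (hA : A ∈ ℐq q) {n : ℕ} {y : Fin n → Y}
    {i : genStr 𝒜 y → Z} (hi : IsEmbedding i) {f : genStr 𝒜 y → A} (hf : IsMorphism f) :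
    ∃ g : Z → A, IsMorphism g ∧ ∀ x, g (i x) = f x := by
  obtain ⟨g, hg, hgf⟩ := H.enough.extend _ (H.genStr_mem hY y) Z hZ A (Set.mem_iUnion.2 ⟨q, hA⟩)
    (fg_genStr hY y) (separableSpace_genStr hYsep y) hZsep (H.inj_separable q A hA) i f 0
    hi.isMorphism hf (by simp [hi.distortion_eq_zero])
  refine ⟨g, hg, fun x => dist_le_zero.1 ?_⟩
  simpa [H.modulus.2.1] using dist_le_of_unifDist_le hgf x

/-- A Gromov–Hausdorff approximation of `⟨y⟩` by `⟨a⟩` gives maps `f` and `g`; by injectivity of `A`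
the map `f`, viewed in `A`, extends to all of `Y`. The return map `g` is defined on `⟨a⟩` only:
extending it to `A` requires a property of `Y`. -/
theorem exists_approx (H : IsStratifiedClass 𝒜 𝒜q ℐq ℐ ϖ) {Y : Str.{v, u} L} (hY : Y ∈ 𝒜)
    (hYsep : TopologicalSpace.SeparableSpace Y) {n : ℕ} (y : Fin n → Y) {ε : ℝ≥0} (hε : 0 < ε) :
    ∃ q, ∃ A ∈ ℐq q, ∃ (m : ℕ) (a : Fin m → A) (p : Y → A) (f : genStr 𝒜 y → genStr 𝒜 a)
      (g : genStr 𝒜 a → genStr 𝒜 y), IsMorphism p ∧ IsMorphism g ∧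
        (∀ x, p (genVal 𝒜 y x) = genVal 𝒜 a (f x)) ∧ (∀ x, dist (g (f x)) x ≤ ε) ∧
        distortion (p ∘ genVal 𝒜 y) < ε := by
  obtain ⟨A, hA, m, a, hgh⟩ := H.enough.approx _ (H.genStr_mem hY y) (fg_genStr hY y) ε
    (by exact_mod_cast hε)
  obtain ⟨q, hA⟩ := Set.mem_iUnion.1 hA
  obtain ⟨f, g, hf, hg, hgf, hfε⟩ := exists_of_ghDist_lt hgh
  obtain ⟨p, hp, hpf⟩ := H.exists_extension hY hYsep hY hYsep hA (isEmbedding_genVal y)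
    ((isEmbedding_genVal a).isMorphism.comp hf)
  refine ⟨q, A, hA, m, a, p, f, g, hp, hg, hpf, dist_le_of_unifDist_le hgf.le, ?_⟩
  rw [show p ∘ genVal 𝒜 y = genVal 𝒜 a ∘ f from funext hpf,
    (isEmbedding_genVal (𝒜 := 𝒜) a).distortion_comp]
  exact hfε

/-- The identity of the Fraïssé limit approximately factors through members of `ℐ_∞`. -/
theorem exists_factor_limit (H : IsStratifiedClass 𝒜 𝒜q ℐq ℐ ϖ) (hM : IsFraisseLimit 𝒜 ϖ M) {n : ℕ}
    (y : Fin n → M) {ε : ℝ≥0} (hε : 0 < ε) :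
    ∃ q, ∃ A ∈ ℐq q, ∃ (p : M → A) (s : A → M), IsMorphism p ∧ IsMorphism s ∧
      (∀ i, dist (s (p (y i))) (y i) ≤ ε) ∧ distortion (p ∘ genVal 𝒜 y) < ε := by
  have hε2 : 0 < (ε : ℝ) / 2 := by positivity
  obtain ⟨δ, hδ₀, hδ, hϖδ⟩ := H.modulus.exists_lt hε2
  obtain ⟨q, A, hA, m, a, p, f, g, hp, -, -, -, hpδ⟩ := H.exists_approx hM.1 hM.2.1 y hδ₀
  obtain ⟨s, hs, hsy⟩ := hM.exists_isEmbedding H.modulus H.base (H.mem_of_mem_inj hA)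
    (H.inj_separable q A hA) y hp hpδ hε2
  refine ⟨q, A, hA, p, s, hp, hs.isMorphism, fun i => (hsy i).trans (by linarith),
    hpδ.trans_le ?_⟩
  have : (δ : ℝ) ≤ ε := by linarith
  exact_mod_cast this

/-- A morphism from `⟨a⟩` to an approximately injective structure, where `a` is a tuple in a member
of `ℐ_∞`, approximately extends on any finite tuple in `⟨a⟩`. -/
theorem exists_approx_extension (H : IsStratifiedClass 𝒜 𝒜q ℐq ℐ ϖ)
    (hinj : IsApproxInjective 𝒜 ℐ X) {q : ℕ} {A : Str.{v, u} L} (hA : A ∈ ℐq q) {m : ℕ}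
    (a : Fin m → A) {g : genStr 𝒜 a → X} (hg : IsMorphism g) {n : ℕ} (w : Fin n → genStr 𝒜 a)
    {ε : ℝ} (hε : 0 < ε) :
    ∃ s : A → X, IsMorphism s ∧ ∀ i, dist (s (genVal 𝒜 a (w i))) (g (w i)) ≤ ε := by
  have hAsep := H.inj_separable q A hA
  obtain ⟨A', hA', i, hi⟩ := H.cofinal A (Set.mem_iUnion.2 ⟨q, hA⟩)
  obtain ⟨q', hAq'⟩ := Set.mem_iUnion.1 (H.cofinal_subset hA')
  -- The structure generated by the image of `w` in `A'` may exceed the image of the one generated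
  -- in `A`. The map `r`, which undoes `i` on `⟨a⟩`, sends it back into `⟨a⟩`, where `g` is defined.
  obtain ⟨r, hr, hri⟩ := H.exists_extension (H.mem_of_mem_inj hA) hAsep (H.mem_of_mem_inj hAq')
    (H.inj_separable q' A' hAq') hA (hi.comp (isEmbedding_genVal a))
    (isEmbedding_genVal (𝒜 := 𝒜) a).isMorphism
  replace hri : ∀ x, r (i (genVal 𝒜 a x)) = genVal 𝒜 a x := hri
  obtain ⟨R, hR, hRr⟩ := hr.exists_genMap (𝒜 := 𝒜) (a := fun k => i (genVal 𝒜 a (w k))) (b := a)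
    fun k => by rw [hri]; exact (w k).2
  obtain ⟨s, hs, hsg⟩ := hinj A' hA' n (fun k => i (genVal 𝒜 a (w k))) (g ∘ R) (hg.comp hR) ε hε
  refine ⟨s ∘ i, hs.comp hi.isMorphism, fun k => ?_⟩
  have hRk : R (genTuple 𝒜 (fun k => i (genVal 𝒜 a (w k))) k) = w k :=
    Subtype.ext ((congrFun hRr _).trans (hri (w k)))
  have h := (dist_le_pi_dist _ _ k).trans hsg
  simpa only [Function.comp_apply, hRk] using h

/-- The identity of a separable approximately injective structure approximately factors through
members of `ℐ_∞`. -/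
theorem exists_factor_approxInjective (H : IsStratifiedClass 𝒜 𝒜q ℐq ℐ ϖ) (hX : X ∈ 𝒜)
    (hXsep : TopologicalSpace.SeparableSpace X) (hinj : IsApproxInjective 𝒜 ℐ X) {n : ℕ}
    (x : Fin n → X) {ε : ℝ≥0} (hε : 0 < ε) :
    ∃ q, ∃ A ∈ ℐq q, ∃ (p : X → A) (s : A → X), IsMorphism p ∧ IsMorphism s ∧
      ∀ i, dist (s (p (x i))) (x i) ≤ ε := by
  have hε2 : 0 < ε / 2 := half_pos hε
  obtain ⟨q, A, hA, m, a, p, f, g, hp, hg, hpf, hgf, -⟩ := H.exists_approx hX hXsep x hε2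
  obtain ⟨s, hs, hsg⟩ := H.exists_approx_extension hinj hA a
    ((isEmbedding_genVal x).isMorphism.comp hg) (fun i => f (genTuple 𝒜 x i))
    (NNReal.coe_pos.2 hε2)
  refine ⟨q, A, hA, p, s, hp, hs, fun i => ?_⟩
  have h₁ := hsg i
  rw [← hpf] at h₁
  have h₂ : dist (genVal 𝒜 x (g (f (genTuple 𝒜 x i)))) (x i) ≤ (ε / 2 : ℝ≥0) :=
    hgf (genTuple 𝒜 x i)
  have h₃ := dist_triangle (s (p (x i))) (genVal 𝒜 x (g (f (genTuple 𝒜 x i)))) (x i)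
  have h₄ : dist (s (p (x i))) (genVal 𝒜 x (g (f (genTuple 𝒜 x i)))) ≤ (ε / 2 : ℝ≥0) := h₁
  push_cast at h₂ h₄
  linarith

/-- Finitely generated structures are separable. -/
theorem separableSpace_of_fg (H : IsStratifiedClass 𝒜 𝒜q ℐq ℐ ϖ) {Y : Str.{v, u} L} (hY : Y ∈ 𝒜)
    (hfg : FG 𝒜 Y) : TopologicalSpace.SeparableSpace Y := by
  have : SecondCountableTopology Y := by
    refine Metric.secondCountable_of_almost_dense_set fun ε hε => ?_
    lift ε to ℝ≥0 using hε.le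
    have hε2 : 0 < ε / 2 := half_pos (by exact_mod_cast hε)
    obtain ⟨A, hA, m, a, hgh⟩ := H.enough.approx Y hY hfg (ε / 2 : ℝ≥0) (by exact_mod_cast hε2)
    obtain ⟨q, hA⟩ := Set.mem_iUnion.1 hA
    obtain ⟨f, g, hf, hg, hgf, -⟩ := exists_of_ghDist_lt hgh
    have hsep := separableSpace_genStr (𝒜 := 𝒜) (H.inj_separable q A hA) a
    obtain ⟨S, hS, hSd⟩ := TopologicalSpace.exists_countable_dense (genStr 𝒜 a)
    refine ⟨g '' S, hS.image g, fun x => ?_⟩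
    obtain ⟨z, hz, hxz⟩ := hSd.exists_dist_lt (f x) (ε := (ε / 2 : ℝ≥0)) (by exact_mod_cast hε2)
    refine ⟨g z, Set.mem_image_of_mem g hz, ?_⟩
    have h₁ := dist_le_of_unifDist_le hgf.le x
    have h₂ := hg.dist_le (f x) z
    have h₃ := dist_triangle x (g (f x)) (g z)
    rw [dist_comm x (g (f x))] at h₃
    change dist (g (f x)) x ≤ _ at h₁
    push_cast at h₁ hxz
    linarith
  infer_instance

/-- There are morphisms from every separable structure to every member of `ℐ_∞`. -/
theorem exists_isMorphism (H : IsStratifiedClass 𝒜 𝒜q ℐq ℐ ϖ) {Y A : Str.{v, u} L} (hY : Y ∈ 𝒜)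
    (hYsep : TopologicalSpace.SeparableSpace Y) {q : ℕ} (hA : A ∈ ℐq q) :
    ∃ f : Y → A, IsMorphism f := by
  obtain ⟨A₀, hfg, hA₀⟩ := H.base.initial
  obtain ⟨i, hi, -⟩ := hA₀.2 Y hY
  obtain ⟨k, hk, -⟩ := hA₀.2 A (H.mem_of_mem_inj hA)
  -- Finite distortion suffices: the extension of `k` along `i` may have a large error, but only its
  -- existence matters.
  have hfin := H.initial_finite A₀ hA₀ Y hY i hi
  obtain ⟨g, hg, -⟩ := H.enough.extend A₀ hA₀.1 Y hY A (Set.mem_iUnion.2 ⟨q, hA⟩) hfg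
    (H.separableSpace_of_fg hA₀.1 hfg) hYsep (H.inj_separable q A hA) i k (distortion i).toNNReal
    hi hk (ENNReal.coe_toNNReal hfin.ne).ge
  exact ⟨g, hg⟩

/-- The metric on pairs of morphisms into a product. -/
theorem dist_product_le (H : IsStratifiedClass 𝒜 𝒜q ℐq ℐ ϖ) {q : ℕ} {Y : Bool → Str.{v, u} L}
    (hY : ∀ i, Y i ∈ 𝒜q q) {P : Str.{v, u} L} {π : ∀ i, P → Y i} (hP : IsProduct (𝒜q q) Y P π)
    {C : Str.{v, u} L} (hC : C ∈ 𝒜q q) {f g : C → P} (hf : IsMorphism f) (hg : IsMorphism g)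
    (c : C) {ε : ℝ} (h : ∀ i, dist (π i (f c)) (π i (g c)) ≤ ε) : dist (f c) (g c) ≤ ε := by
  have hm : ∀ k, IsMorphism (![f, g] k) := by
    intro k
    fin_cases k
    exacts [hf, hg]
  -- Two morphisms evaluated at one point, with the distance between the two values as atomic
  -- formula.
  have hle := (H.strata q).product_max Y hY P π hP C hC 2 (fun k => π false ∘ ![f, g] k)
    (fun k => π true ∘ ![f, g] k) ![f, g] (fun k => (hP.2.1 false).comp (hm k))
    (fun k => (hP.2.1 true).comp (hm k)) hm (fun _ _ => rfl) (fun _ _ => rfl) 1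
    (.dist (.var (0, 0)) (.var (1, 0))) ![c]
  simp only [Atomic.eval, Term.eval, Matrix.cons_val_zero, Matrix.cons_val_one,
    Function.comp_apply] at hle
  exact hle.trans (max_le (h false) (h true))

end IsStratifiedClass

end Stratified

theorem IsEmbedding.dist_eq {E F : Str.{v, u} L} {T : E → F} (hT : IsEmbedding T) (x y : E) :
    dist (T x) (T y) = dist x y := by
  simpa [Atomic.eval, Term.eval] using hT 2 (.dist (.var 0) (.var 1)) ![x, y]

theorem IsEmbedding.injective {E F : Str.{v, u} L} {T : E → F} (hT : IsEmbedding T) :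
    Function.Injective T :=
  fun x y h => dist_eq_zero.1 (by rw [← hT.dist_eq, h, dist_self])

/-! ### Retracts of the Fraïssé limit -/

section Retract

variable {𝒜 : Set (Str.{v, u} L)} {𝒜q ℐq : ℕ → Set (Str.{v, u} L)} {ℐ : Set (Str.{v, u} L)}
  {ϖ : ℝ≥0 → ℝ≥0} {M X : Str.{v, u} L}

namespace IsStratifiedClass

/-- Binary products of members of `ℐq q`, with the metric on morphisms into them. -/
theorem exists_binary_product (H : IsStratifiedClass 𝒜 𝒜q ℐq ℐ ϖ) {q : ℕ} {A C : Str.{v, u} L}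
    (hA : A ∈ ℐq q) (hC : C ∈ ℐq q) :
    ∃ P ∈ ℐq q, ∃ (π₁ : P → A) (π₂ : P → C), IsMorphism π₁ ∧ IsMorphism π₂ ∧
      (∀ Z ∈ 𝒜q q, ∀ (f : Z → A) (g : Z → C), IsMorphism f → IsMorphism g →
        ∃ h : Z → P, IsMorphism h ∧ (∀ z, π₁ (h z) = f z) ∧ ∀ z, π₂ (h z) = g z) ∧
      ∀ Z ∈ 𝒜q q, ∀ f g : Z → P, IsMorphism f → IsMorphism g → ∀ z ε,
        dist (π₁ (f z)) (π₁ (g z)) ≤ ε → dist (π₂ (f z)) (π₂ (g z)) ≤ ε →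
          dist (f z) (g z) ≤ ε := by
  let Y : Bool → Str.{v, u} L := fun b => match b with
    | false => A
    | true => C
  have hY : ∀ i, Y i ∈ ℐq q := by
    rintro (_ | _)
    exacts [hA, hC]
  obtain ⟨P, hPI, π, hP⟩ := H.inj_products q Y hY
  refine ⟨P, hPI, π false, π true, hP.2.1 false, hP.2.1 true, fun Z hZ f g hf hg => ?_,
    fun Z hZ f g hf hg z ε h₁ h₂ => ?_⟩
  · let F : ∀ i, Z → Y i := fun i => match i with
      | false => f
      | true => g
    have hF : ∀ i, IsMorphism (F i) := by
      rintro (_ | _)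
      exacts [hf, hg]
    obtain ⟨h, ⟨hh, hhF⟩, -⟩ := hP.2.2 Z hZ F hF
    exact ⟨h, hh, hhF false, hhF true⟩
  · refine H.dist_product_le (fun i => (H.inj_injective q _ (hY i)).1) hP hZ hf hg z ?_
    rintro (_ | _)
    exacts [h₁, h₂]

/-- Inductive step: a pair of morphisms `j : X → M`, `r : M → X` with `r ∘ j` close to the identity
on `x` is approximated by one for which `r' ∘ j'` is closer to the identity on a larger tuple. -/
theorem exists_better_pair (H : IsStratifiedClass 𝒜 𝒜q ℐq ℐ ϖ) (hM : IsFraisseLimit 𝒜 ϖ M)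
    (hX : X ∈ 𝒜) (hXsep : TopologicalSpace.SeparableSpace X) (hinj : IsApproxInjective 𝒜 ℐ X)
    {j : X → M} {r : M → X} (hj : IsMorphism j) (hr : IsMorphism r) {n : ℕ} (x : Fin n → X) {δ : ℝ}
    (hδ₀ : 0 ≤ δ) (hδ : ∀ i, dist (r (j (x i))) (x i) ≤ δ) {n' : ℕ} (x' : Fin n' → X) {m : ℕ}
    (u : Fin m → M) {η : ℝ} (hη : 0 < η) :
    ∃ (j' : X → M) (r' : M → X), IsMorphism j' ∧ IsMorphism r' ∧
      (∀ i, dist (r' (j' (x' i))) (x' i) ≤ η) ∧ (∀ i, dist (j' (x i)) (j (x i)) ≤ δ + η) ∧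
      ∀ i, dist (r' (u i)) (r (u i)) ≤ η := by
  obtain ⟨ε, hε₀, hε, hϖε⟩ := H.modulus.exists_lt (show 0 < η / 8 by positivity)
  obtain ⟨q₁, A, hA, p, s, hp, hs, hsp, hpε⟩ := H.exists_factor_limit hM (Fin.append u (j ∘ x)) hε₀
  obtain ⟨q₂, C, hC, p', s', hp', hs', hsp'⟩ := H.exists_factor_approxInjective hX hXsep hinj
    (Fin.append (Fin.append x' x) (r ∘ u)) hε₀
  have hspu : ∀ i, dist (s (p (u i))) (u i) ≤ ε := fun i => by
    simpa only [Fin.append_left] using hsp (Fin.castAdd n i)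
  have hspj : ∀ i, dist (s (p (j (x i)))) (j (x i)) ≤ ε := fun i => by
    simpa only [Fin.append_right, Function.comp_apply] using hsp (Fin.natAdd m i)
  have hsx' : ∀ i, dist (s' (p' (x' i))) (x' i) ≤ ε := fun i => by
    simpa only [Fin.append_left] using hsp' (Fin.castAdd m (Fin.castAdd n i))
  have hsx : ∀ i, dist (s' (p' (x i))) (x i) ≤ ε := fun i => by
    simpa only [Fin.append_left, Fin.append_right] using hsp' (Fin.castAdd m (Fin.natAdd n' i))
  have hsu : ∀ i, dist (s' (p' (r (u i)))) (r (u i)) ≤ ε := fun i => by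
    simpa only [Fin.append_right, Function.comp_apply] using hsp' (Fin.natAdd (n' + n) i)
  -- Both factors are moved to a common stratum, where their product exists. The universal property
  -- is applied only to maps from `A` and `C`, as `M` and `X` need not lie in a stratum.
  have hmono : Monotone ℐq := monotone_nat_of_le_succ H.inj_mono
  replace hA := hmono (le_max_left q₁ q₂) hA
  replace hC := hmono (le_max_right q₁ q₂) hC
  obtain ⟨P, hP, π₁, π₂, hπ₁, hπ₂, hpair, hdist⟩ := H.exists_binary_product hA hC
  have hPA := H.mem_of_mem_inj hP
  have hPsep := H.inj_separable _ P hP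
  have hCq := (H.inj_injective _ C hC).1
  -- `l` is the graph of `r` and `k` the graph of `j`, both read through the factorizations.
  obtain ⟨l, hl, hl₁, hl₂⟩ := hpair A (H.inj_injective _ A hA).1 id (p' ∘ r ∘ s) isMorphism_id
    (hp'.comp (hr.comp hs))
  obtain ⟨k, hk, hk₁, hk₂⟩ := hpair C hCq (p ∘ j ∘ s') id (hp.comp (hj.comp hs')) isMorphism_id
  have hlp : IsMorphism (l ∘ p) := hl.comp hp
  have hlpε : distortion ((l ∘ p) ∘ genVal 𝒜 (Fin.append u (j ∘ x))) < ε := by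
    refine (distortion_le_comp hπ₁ (hlp.comp (isEmbedding_genVal _).isMorphism)).trans_lt ?_
    convert hpε using 2
    exact funext fun y => hl₁ _
  obtain ⟨G, hG, hGl⟩ := hM.exists_isEmbedding H.modulus H.base hPA hPsep _ hlp hlpε
    (show 0 < η / 8 by positivity)
  have hGu : ∀ i, dist (G (l (p (u i)))) (u i) ≤ η / 4 := fun i => by
    have h := hGl (Fin.castAdd n i)
    simp only [Fin.append_left, Function.comp_apply] at h
    linarith
  have hGj : ∀ i, dist (G (l (p (j (x i))))) (j (x i)) ≤ η / 4 := fun i => by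
    have h := hGl (Fin.natAdd m i)
    simp only [Fin.append_right, Function.comp_apply] at h
    linarith
  -- An exact left inverse of `G` is needed only on the points at which `r'` will be evaluated after
  -- `G`.
  let w : Fin (n' + m) → P := Fin.append (k ∘ p' ∘ x') (l ∘ p ∘ u)
  obtain ⟨h, hh, hhG⟩ := H.exists_extension hPA hPsep hM.1 hM.2.1 hP
    (hG.comp (isEmbedding_genVal (𝒜 := 𝒜) w)) (isEmbedding_genVal w).isMorphism
  have hhx : ∀ i, h (G (k (p' (x' i)))) = k (p' (x' i)) := fun i => by
    have h₁ : h (G (w (Fin.castAdd m i))) = w (Fin.castAdd m i) := hhG (genTuple 𝒜 w _)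
    simpa only [w, Fin.append_left, Function.comp_apply] using h₁
  have hhu : ∀ i, h (G (l (p (u i)))) = l (p (u i)) := fun i => by
    have h₁ : h (G (w (Fin.natAdd n' i))) = w (Fin.natAdd n' i) := hhG (genTuple 𝒜 w _)
    simpa only [w, Fin.append_right, Function.comp_apply] using h₁
  have hr' : IsMorphism (s' ∘ π₂ ∘ h) := hs'.comp (hπ₂.comp hh)
  refine ⟨G ∘ k ∘ p', s' ∘ π₂ ∘ h, hG.isMorphism.comp (hk.comp hp'), hr', fun i => ?_, fun i => ?_,
    fun i => ?_⟩
  · simp only [Function.comp_apply, hhx, hk₂, id]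
    linarith [hsx' i]
  · have h₁ : dist (p' (x i)) (p' (r (s (p (j (s' (p' (x i)))))))) ≤ δ + 2 * ε := by
      have a₁ := hp'.dist_le (x i) (r (s (p (j (s' (p' (x i)))))))
      have a₂ := dist_triangle4 (x i) (r (j (x i))) (r (s (p (j (x i)))))
        (r (s (p (j (s' (p' (x i)))))))
      have a₃ := (hr.dist_le (j (x i)) (s (p (j (x i)))))
      have a₄ := (hr.comp (hs.comp (hp.comp hj))).dist_le (x i) (s' (p' (x i)))
      simp only [Function.comp_apply] at a₄
      have a₅ := hδ i
      have a₆ := hspj i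
      have a₇ := hsx i
      rw [dist_comm] at a₅ a₆ a₇
      linarith
    -- The first coordinates coincide, both being `p (j (s' (p' (x i))))`. The second ones differ by
    -- about the defect `δ` of `r ∘ j`, which is `h₁`.
    have h₂ : dist (k (p' (x i))) (l (p (j (s' (p' (x i)))))) ≤ δ + 2 * ε := by
      refine hdist C hCq k (l ∘ p ∘ j ∘ s') hk (hl.comp (hp.comp (hj.comp hs'))) (p' (x i)) _ ?_ ?_
      · simp only [hk₁, hl₁, Function.comp_apply, id, dist_self]
        positivity
      · simpa only [hk₂, hl₂, Function.comp_apply, id] using h₁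
    have h₃ := (hl.comp (hp.comp hj)).dist_le (s' (p' (x i))) (x i)
    have h₄ := hG.dist_eq (k (p' (x i))) (l (p (j (x i))))
    have h₅ := dist_triangle (k (p' (x i))) (l (p (j (s' (p' (x i)))))) (l (p (j (x i))))
    have h₆ := dist_triangle (G (k (p' (x i)))) (G (l (p (j (x i))))) (j (x i))
    simp only [Function.comp_apply] at h₃ ⊢
    linarith [hsx i, hGj i]
  · have h₁ := hr'.dist_le (u i) (G (l (p (u i))))
    simp only [Function.comp_apply, hhu, hl₂] at h₁ ⊢
    have h₂ := (hs'.comp (hp'.comp hr)).dist_le (s (p (u i))) (u i)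
    simp only [Function.comp_apply] at h₂
    have h₃ := dist_triangle4 (s' (π₂ (h (u i)))) (s' (p' (r (s (p (u i))))))
      (s' (p' (r (u i)))) (r (u i))
    rw [dist_comm (u i)] at h₁
    linarith [hsu i, hGu i, hspu i]

/-- A separable approximately injective structure is a retract of the Fraïssé limit. -/
theorem exists_retraction (H : IsStratifiedClass 𝒜 𝒜q ℐq ℐ ϖ) (hM : IsFraisseLimit 𝒜 ϖ M)
    (hX : X ∈ 𝒜) (hXsep : TopologicalSpace.SeparableSpace X) (hinj : IsApproxInjective 𝒜 ℐ X) :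
    ∃ (η : X → M) (τ : M → X), IsMorphism η ∧ IsMorphism τ ∧ ∀ x, τ (η x) = x := by
  obtain ⟨j₀, r₀, hj₀, hr₀⟩ : ∃ (j : X → M) (r : M → X), IsMorphism j ∧ IsMorphism r := by
    -- Empty tuples: the factorizations serve only to provide some morphisms `A → M` and `C → X`.
    obtain ⟨q₁, A, hA, p, s, hp, hs, -⟩ := H.exists_factor_limit hM Fin.elim0 one_pos
    obtain ⟨q₂, C, hC, p', s', hp', hs', -⟩ :=
      H.exists_factor_approxInjective hX hXsep hinj Fin.elim0 one_pos
    obtain ⟨f, hf⟩ := H.exists_isMorphism hX hXsep hA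
    obtain ⟨g, hg⟩ := H.exists_isMorphism hM.1 hM.2.1 hC
    exact ⟨s ∘ f, s' ∘ g, hs.comp hf, hs'.comp hg⟩
  rcases isEmpty_or_nonempty X with hempty | hne
  · exact ⟨j₀, r₀, hj₀, hr₀, fun x => isEmptyElim x⟩
  have hMsep := hM.2.1
  have hMne : Nonempty M := hne.map j₀
  set b := TopologicalSpace.denseSeq X with hb
  set c := TopologicalSpace.denseSeq M with hc
  have hbd : DenseRange b := TopologicalSpace.denseRange_denseSeq X
  have hcd : DenseRange c := TopologicalSpace.denseRange_denseSeq M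
  -- The displacement of `j` is at most `1 / 2 ^ N + 1 / 2 ^ (N + 1)`, hence below `2 / 2 ^ N`,
  -- written `4 / 2 / 2 ^ N` to suit `cauchySeq_of_le_geometric_two`. At `N = 0` the conditions are
  -- vacuous.
  obtain ⟨f, -, hf, hff⟩ := exists_seq_of_forall_exists (α := fun _ => (X → M) × (M → X))
    (P := fun N f => IsMorphism f.1 ∧ IsMorphism f.2 ∧
      ∀ i : Fin N, dist (f.2 (f.1 (b i))) (b i) ≤ 1 / 2 ^ N)
    (R := fun N f f' => (∀ i : Fin N, dist (f'.1 (b i)) (f.1 (b i)) ≤ 4 / 2 / 2 ^ N) ∧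
      ∀ i : Fin N, dist (f'.2 (c i)) (f.2 (c i)) ≤ 4 / 2 / 2 ^ N) (j₀, r₀)
    ⟨hj₀, hr₀, fun i => i.elim0⟩ (by
    rintro N ⟨j, r⟩ ⟨hj, hr, hjr⟩
    obtain ⟨j', r', hj', hr', h₁, h₂, h₃⟩ := H.exists_better_pair hM hX hXsep hinj hj hr
      (fun i : Fin N => b i) (by positivity) hjr (fun i : Fin (N + 1) => b i)
      (fun i : Fin N => c i) (η := 1 / 2 ^ (N + 1)) (by positivity)
    have hpos : (0 : ℝ) < 1 / 2 ^ N := by positivity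
    have e₁ : (1 : ℝ) / 2 ^ (N + 1) = 1 / 2 ^ N / 2 := by rw [pow_succ]; ring
    have e₂ : (4 : ℝ) / 2 / 2 ^ N = 2 * (1 / 2 ^ N) := by ring
    refine ⟨(j', r'), ⟨hj', hr', h₁⟩, fun i => (h₂ i).trans ?_, fun i => (h₃ i).trans ?_⟩
    all_goals rw [e₁, e₂]; linarith)
  have hcauchy : ∀ {Z : Str.{v, u} L} (a : ℕ → Z) (i : ℕ),
      (∀ N, i < N → dist (a (N + 1)) (a N) ≤ 4 / 2 / 2 ^ N) → CauchySeq a := by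
    intro Z a i ha
    -- The `i`-th point is controlled only from stage `i + 1` on.
    rw [← cauchySeq_shift (i + 1)]
    refine cauchySeq_of_le_geometric_two (C := 4) fun N => ?_
    rw [dist_comm, show N + 1 + (i + 1) = N + (i + 1) + 1 by ring]
    refine (ha (N + (i + 1)) (by omega)).trans ?_
    gcongr
    · norm_num
    · omega
  obtain ⟨η, hη, hηlim⟩ := exists_tendsto_isMorphism (fun N => (hf N).1) hbd fun i =>
    hcauchy (fun N => (f N).1 (b i)) i fun N hN => (hff N).1 ⟨i, hN⟩
  obtain ⟨τ, hτ, hτlim⟩ := exists_tendsto_isMorphism (fun N => (hf N).2.1) hcd fun i =>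
    hcauchy (fun N => (f N).2 (c i)) i fun N hN => (hff N).2 ⟨i, hN⟩
  refine ⟨η, τ, hη, hτ, fun x => ?_⟩
  refine congrFun (hbd.equalizer (g := fun x => τ (η x)) (h := fun x => x)
    (hτ.continuous.comp hη.continuous) continuous_id (funext fun i => ?_)) x
  have h₁ : Filter.Tendsto (fun N => (f N).2 ((f N).1 (b i))) Filter.atTop (nhds (b i)) := by
    rw [tendsto_iff_dist_tendsto_zero]
    refine squeeze_zero' (Filter.Eventually.of_forall fun _ => dist_nonneg)
      ((Filter.eventually_gt_atTop i).mono fun N hN => (hf N).2.2 ⟨i, hN⟩) ?_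
    exact tendsto_const_nhds.div_atTop (tendsto_pow_atTop_atTop_of_one_lt (by norm_num))
  have h₂ : Filter.Tendsto (fun N => (f N).2 ((f N).1 (b i))) Filter.atTop
      (nhds (τ (η (b i)))) := by
    rw [tendsto_iff_dist_tendsto_zero]
    have h₃ := (tendsto_iff_dist_tendsto_zero.1 (hηlim (b i))).add
      (tendsto_iff_dist_tendsto_zero.1 (hτlim (η (b i))))
    rw [add_zero] at h₃
    -- The maps `(f N).2` are all 1-Lipschitz, so pointwise convergence is enough to pass to the
    -- limit in the composition.
    refine squeeze_zero (fun _ => dist_nonneg) (fun N => ?_) h₃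
    exact (dist_triangle _ ((f N).2 (η (b i))) _).trans
      (add_le_add_left ((hf N).2.1.dist_le _ _) _)
  exact tendsto_nhds_unique h₂ h₁

/-- Retracts of the Fraïssé limit are approximately injective. -/
theorem isApproxInjective_of_retraction (H : IsStratifiedClass 𝒜 𝒜q ℐq ℐ ϖ)
    (hM : IsFraisseLimit 𝒜 ϖ M) {η : X → M} {τ : M → X} (hη : IsMorphism η) (hτ : IsMorphism τ)
    (h : ∀ x, τ (η x) = x) : IsApproxInjective 𝒜 ℐ X := by
  intro A hA n a f hf ε hε
  lift ε to ℝ≥0 using hε.le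
  obtain ⟨q, hAq⟩ := Set.mem_iUnion.1 (H.cofinal_subset hA)
  have hAsep := H.inj_separable q A hAq
  have hAA := H.mem_of_mem_inj hAq
  obtain ⟨q', B, hB, p, s, hp, hs, hsp, -⟩ := H.exists_factor_limit hM
    (fun i => η (f (genTuple 𝒜 a i))) (ε := ε) (by exact_mod_cast hε)
  -- The extension is exact, so the only error is that of the factorization of the identity of `M`
  -- through `B`.
  obtain ⟨k, hk, hkf⟩ := H.exists_extension hAA hAsep hAA hAsep hB (isEmbedding_genVal a)
    (hp.comp (hη.comp hf))
  refine ⟨τ ∘ s ∘ k, hτ.comp (hs.comp hk), (dist_pi_le_iff ε.coe_nonneg).2 fun i => ?_⟩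
  have h₁ : k (a i) = p (η (f (genTuple 𝒜 a i))) := hkf (genTuple 𝒜 a i)
  have h₂ := (hτ.dist_le _ _).trans (hsp i)
  simpa only [Function.comp_apply, h₁, h] using h₂

end IsStratifiedClass

end Retract

end MetricFraisse

/-! ### Approximately injective structures as ranges of idempotents -/

theorem theorem7p2 {L : MetricFraisse.Language} (𝒜 : Set (MetricFraisse.Str L))
    (𝒜q ℐq : ℕ → Set (MetricFraisse.Str L)) (ℐ : Set (MetricFraisse.Str L)) (ϖ : NNReal → NNReal)
    (hclass : MetricFraisse.IsStratifiedClass 𝒜 𝒜q ℐq ℐ ϖ)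
    (M : MetricFraisse.Str L) (hM : MetricFraisse.IsFraisseLimit 𝒜 ϖ M)
    (X : MetricFraisse.Str L) (hX : X ∈ 𝒜) (hXsep : TopologicalSpace.SeparableSpace X) :
    MetricFraisse.IsApproxInjective 𝒜 ℐ X ↔
      ∃ (η : X → M) (π : M → M), MetricFraisse.IsEmbedding η ∧ MetricFraisse.IsMorphism π ∧
        π ∘ π = π ∧ Set.range η = Set.range π := by
  constructor
  · intro hinj
    obtain ⟨η, τ, hη, hτ, h⟩ := hclass.exists_retraction hM hX hXsep hinj
    refine ⟨η, η ∘ τ, hη.isEmbedding_of_leftInverse hτ h, hη.comp hτ, ?_, ?_⟩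
    · funext m
      simp only [Function.comp_apply, h]
    · exact ((Function.LeftInverse.surjective h).range_comp η).symm
  · rintro ⟨η, π, hη, hπ, hππ, hrange⟩
    have hex : ∀ m, ∃ x, η x = π m := fun m => by
      have : π m ∈ Set.range η := hrange ▸ Set.mem_range_self m
      exact this
    choose τ hτ using hex
    -- `τ` is `π` read in `X`: it is a morphism because `η ∘ τ = π` and `η` is an embedding. It is a
    -- left inverse of `η` because `π` fixes its own range, which contains every `η x`.
    refine hclass.isApproxInjective_of_retraction hM hη.isMorphism (τ := τ)
      (hη.isMorphism_of_comp ?_) fun x => hη.injective ?_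
    · rwa [show η ∘ τ = π from funext hτ]
    · obtain ⟨m, hm⟩ : η x ∈ Set.range π := hrange ▸ Set.mem_range_self x
      rw [hτ, ← hm]
      exact congrFun hππ m
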